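/- Let $\mathbf F_q$ be a finite field, $F=\mathbf F_q(X)$ the rational function field, $\mathbf A$ its adele ring (the restricted product of the completions of $F$ at all places, including the place at infinity), $\mathcal O_{\mathbf A}\subset\mathbf A$ the subring of adeles that are integral at every place, $G=\mathrm{GL}_2$, $Z$ the center of $G$, and $K=G(\mathcal O_{\mathbf A})$. Let $\mathcal A$ be the complex vector space of unramified automorphic forms, i.e. of all functions $f\colon G_F\backslash G_{\mathbf A}/KZ_{\mathbf A}\to\mathbf C$. For a quadratic separable field extension $E/F$, an $F$-basis of $E$ identifies $\mathrm{Aut}_F(E)$ with $G_F$, and so gives a non-split torus $T\subset G$ with $T_F\cong E^\times$ and $T_{\mathbf A}\cong(\mathbf A\otimes_F E)^\times$; put $$\mathsf T_F(E)=\Big\{f\in\mathcal A \ \Big|\ \forall g\in G_{\mathbf A}:\ \int_{T_FZ_{\mathbf A}\backslash T_{\mathbf A}} f(tg)\,dt=0\Big\},$$ where $dt$ is a Haar measure on the compact group $T_FZ_{\mathbf A}\backslash T_{\mathbf A}$, and put $\mathsf T_F=\bigcap_E\mathsf T_F(E)$, the intersection being over all quadratic separable $E/F$. (The space $\mathsf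 T_F(E)$ does not depend on the choice of the basis.) Theorem. Let $E=\mathbf F_{q^2}F$ be the quadratic constant extension of $F$. Then, for every choice of the basis (torus) defining $\mathsf T_F(E)$, $$\mathsf T_F=\mathsf T_F(E)=\{0\}.$$ -/

import Mathlib

open scoped TensorProduct
open Polynomial MeasureTheory

universe u v

namespace ToroidalForms

noncomputable section

section Adeles

variable (k : Type u) [Field k]

/-- The completion of `k(X)` at the place at infinity. -/
abbrev CompletionAtInfinity : Type u :=
  @RatFunc.CompletionAtInfty k _ (Classical.decEq _)

/-- The adele ring `𝐀` of the rational function field `F = k(X)`: the restricted product of the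
completions of `F` at all places, i.e. at the place at infinity and at the places given by the
nonzero primes of `k[X]`. -/
abbrev Adele : Type u :=
  CompletionAtInfinity k × IsDedekindDomain.FiniteAdeleRing k[X] (RatFunc k)

/-- The ring `𝒪_𝐀` of integral adeles: the adeles integral at every place. -/
def integralAdeles : Subring (Adele k) where
  carrier := {a | a.1 ∈ (Valued.v (R := CompletionAtInfinity k)).integer ∧
    ∀ v : IsDedekindDomain.HeightOneSpectrum k[X], a.2 v ∈ v.adicCompletionIntegers (RatFunc k)}
  mul_mem' := fun ha hb => ⟨mul_mem ha.1 hb.1, fun v => mul_mem (ha.2 v) (hb.2 v)⟩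
  one_mem' := ⟨one_mem _, fun v => one_mem (v.adicCompletionIntegers (RatFunc k))⟩
  add_mem' := fun ha hb => ⟨add_mem ha.1 hb.1, fun v => add_mem (ha.2 v) (hb.2 v)⟩
  zero_mem' := ⟨zero_mem _, fun v => zero_mem (v.adicCompletionIntegers (RatFunc k))⟩
  neg_mem' := fun ha => ⟨neg_mem ha.1, fun v => neg_mem (ha.2 v)⟩

/-- The group `G_𝐀 = GL₂(𝐀)`, with its topology as the unit group of the matrix ring. -/
abbrev GLAdele : Type u := GL (Fin 2) (Adele k)

/-- The diagonal embedding of `G_F = GL₂(F)` into `G_𝐀`. -/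
def rationalPoints : GL (Fin 2) (RatFunc k) →* GLAdele k :=
  Matrix.GeneralLinearGroup.map (algebraMap (RatFunc k) (Adele k))

/-- The standard maximal compact subgroup `K = GL₂(𝒪_𝐀)` of `G_𝐀`. -/
def maximalCompact : Subgroup (GLAdele k) :=
  (Matrix.GeneralLinearGroup.map (n := Fin 2) (integralAdeles k).subtype).range

/-- The adelic points `Z_𝐀` of the center of `GL₂`: the scalar matrices. -/
def centerAdele : Subgroup (GLAdele k) :=
  (Matrix.GeneralLinearGroup.scalar (Fin 2) (R := Adele k)).range

/-- The space `𝒜` of unramified automorphic forms: all functions `G_F \ G_𝐀 / K Z_𝐀 → ℂ`. -/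
def unramifiedForms : Submodule ℂ (GLAdele k → ℂ) where
  carrier := {f | (∀ γ g, f (rationalPoints k γ * g) = f g) ∧
    (∀ κ ∈ maximalCompact k, ∀ g, f (g * κ) = f g) ∧
    (∀ z ∈ centerAdele k, ∀ g, f (g * z) = f g)}
  add_mem' := by
    rintro f₁ f₂ ⟨h1, h2, h3⟩ ⟨h1', h2', h3'⟩
    refine ⟨fun γ g => ?_, fun κ hκ g => ?_, fun z hz g => ?_⟩
    · simp only [Pi.add_apply, h1, h1']
    · simp only [Pi.add_apply, h2 κ hκ, h2' κ hκ]
    · simp only [Pi.add_apply, h3 z hz, h3' z hz]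
  zero_mem' := ⟨fun _ _ => rfl, fun _ _ _ => rfl, fun _ _ _ => rfl⟩
  smul_mem' := by
    rintro c f ⟨h1, h2, h3⟩
    refine ⟨fun γ g => ?_, fun κ hκ g => ?_, fun z hz g => ?_⟩
    · simp only [Pi.smul_apply, h1]
    · simp only [Pi.smul_apply, h2 κ hκ]
    · simp only [Pi.smul_apply, h3 z hz]

end Adeles

section Torus

variable {k : Type u} [Field k] {E : Type v} [Field E] [Algebra (RatFunc k) E]
  (b : Module.Basis (Fin 2) (RatFunc k) E)

/-- An `F`-basis `b` of `E` identifies `Aut_F(E)` with `GL₂(F)` and, after base change to the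
adeles, it embeds `(𝐀 ⊗_F E)ˣ` in `GL₂(𝐀)` through multiplication on `𝐀 ⊗_F E`. -/
def torusEmbedding : (Adele k ⊗[RatFunc k] E)ˣ →* GLAdele k :=
  Units.map (Algebra.leftMulMatrix (b.baseChange (Adele k))).toMonoidHom

/-- The adelic points `T_𝐀` of the torus `T` of `GL₂` given by the basis `b` of `E`. -/
def torusAdele : Subgroup (GLAdele k) := (torusEmbedding b).range

/-- The rational points `T_F ≅ Eˣ` of the torus, as a subgroup of `G_𝐀`. -/
def torusRational : Subgroup (GLAdele k) :=
  ((torusEmbedding b).comp (Units.map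
    (Algebra.TensorProduct.includeRight : E →ₐ[RatFunc k] Adele k ⊗[RatFunc k] E).toMonoidHom)).range

instance : IsMulCommutative (torusAdele b) :=
  IsMulCommutative.of_setLike_mul_comm (by
    rintro _ ⟨x, rfl⟩ _ ⟨y, rfl⟩
    rw [← map_mul, ← map_mul]
    exact congrArg _ (Units.ext (mul_comm x.val y.val)))

/-- The topological group `T_F Z_𝐀 \ T_𝐀`. -/
abbrev TorusQuotient : Type u :=
  torusAdele b ⧸ (torusRational b ⊔ centerAdele k).subgroupOf (torusAdele b)

instance : MeasurableSpace (TorusQuotient b) := borel _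

instance : BorelSpace (TorusQuotient b) := ⟨rfl⟩

theorem torusRational_le_range :
    torusRational b ≤ (rationalPoints k).range := by
  rintro _ ⟨e, rfl⟩
  refine ⟨Units.map (Algebra.leftMulMatrix b).toMonoidHom e, ?_⟩
  ext i j : 2
  simp [torusEmbedding, rationalPoints, Algebra.leftMulMatrix_eq_repr_mul,
    Algebra.TensorProduct.tmul_mul_tmul, Module.Basis.baseChange_apply,
    Module.Basis.baseChange_repr_tmul, Algebra.smul_def]

theorem unramifiedForms_left_invariant {f : GLAdele k → ℂ} (hf : f ∈ unramifiedForms k)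
    {h : GLAdele k} (hh : h ∈ torusRational b ⊔ centerAdele k) (x : GLAdele k) :
    f (h * x) = f x := by
  let S : Subgroup (GLAdele k) :=
    { carrier := {h | ∀ x, f (h * x) = f x}
      mul_mem' := fun {a c} ha hc x => by rw [mul_assoc, ha, hc]
      one_mem' := fun x => by rw [one_mul]
      inv_mem' := fun {a} ha x => by rw [← ha, mul_inv_cancel_left] }
  have hS : torusRational b ⊔ centerAdele k ≤ S := by
    refine sup_le ?_ ?_
    · intro t ht x
      obtain ⟨γ, rfl⟩ := torusRational_le_range b ht
      exact hf.1 γ x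
    · rintro _ ⟨a, rfl⟩ x
      have hc : Matrix.GeneralLinearGroup.scalar (Fin 2) a * x
          = x * Matrix.GeneralLinearGroup.scalar (Fin 2) a :=
        Units.ext (Matrix.scalar_commute (a : Adele k) (fun r => mul_comm _ r) x.val)
      rw [hc]
      exact hf.2.2 _ ⟨a, rfl⟩ x
  exact hS hh x

/-- The function `t ↦ f (t g)` on `T_F Z_𝐀 \ T_𝐀`. -/
def torusFunction (f : unramifiedForms k) (g : GLAdele k) : TorusQuotient b → ℂ :=
  Quotient.lift (fun t : torusAdele b => f.1 (t * g)) (by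
    intro s t hst
    have h : s⁻¹ * t ∈ (torusRational b ⊔ centerAdele k).subgroupOf (torusAdele b) :=
      QuotientGroup.leftRel_apply.mp hst
    have hcomm : t = (s⁻¹ * t) * s := by
      rw [mul_comm' (s⁻¹ * t) s, mul_inv_cancel_left]
    have h2 := unramifiedForms_left_invariant b f.2 (Subgroup.mem_subgroupOf.mp h) (s * g)
    rw [← mul_assoc, ← Subgroup.coe_mul, ← hcomm] at h2
    exact h2.symm)

/-- The space `T_F(E)` of toroidal automorphic forms with respect to the torus given by the basis
`b` of `E`: those `f ∈ 𝒜` with `∫_{T_F Z_𝐀 \ T_𝐀} f (t g) dt = 0` for all `g ∈ G_𝐀`, where `dt` is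
Haar measure (since Haar measure is only defined up to scaling, the condition is asked for every
normalization). -/
def toroidalFormsWith : Set (unramifiedForms k) :=
  {f | ∀ g : GLAdele k, ∀ μ : Measure (TorusQuotient b), μ.IsHaarMeasure →
    ∫ t, torusFunction b f g t ∂μ = 0}

end Torus

/-- The space `T_F` of toroidal automorphic forms for `F = k(X)`: the intersection of the spaces
`T_F(E)` over all quadratic separable extensions `E` of `F` (and all tori, i.e. all bases of
`E`). -/
def toroidalForms (k : Type u) [Field k] : Set (unramifiedForms k) :=
  {f | ∀ (E : Type u) [Field E] [Algebra (RatFunc k) E] [Algebra.IsSeparable (RatFunc k) E]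
    (b : Module.Basis (Fin 2) (RatFunc k) E), f ∈ toroidalFormsWith b}

/-- `E` is the quadratic constant extension of `F = k(X)`: it is the compositum of `F` and a
quadratic extension of `k`. -/
def IsQuadraticConstantExtension (k : Type u) [Field k] (E : Type v) [Field E] [Algebra k E]
    [Algebra (RatFunc k) E] : Prop :=
  ∃ l : IntermediateField k E, Module.finrank k l = 2 ∧
    IntermediateField.adjoin (RatFunc k) (l : Set E) = ⊤

end

end ToroidalForms

/-! Write d_n for `diagAdele n`. Every class in G_F\G_𝐀/KZ_𝐀 contains some d_n with n ≥ 0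
(`exists_adelic_decomposition`): geometrically, a rank two bundle on the projective line is, up to a
twist, O(n) ⊕ O. So a form f is zero once all values f(d_n) are, and these are killed by strong
induction on n.

Let ω generate the constant field of E over k. Multiplication by ω is a matrix W, conjugate by some
g₀ in G_F to its companion matrix W₀, which has constant entries, and T_𝐀 is the centralizer of W.
For a constant extension, T_𝐀 = T_F · (T_𝐀 ∩ g₀Kg₀⁻¹) · Z_𝐀 (`exists_torus_decomposition`). Indeed,
if t g₀ = γ d_n κ z, then γ⁻¹Wγ is an endomorphism of the bundle attached to d_n without rational
eigenvalue. This forces n = 0 and constant entries, and then a constant change of basis, an element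
of K, carries γ⁻¹Wγ to W₀.

Hence on the torus orbit of g₀d_n the form takes only values f(κd_n) with κ in K, and κd_n lies in
the class of some d_j with j ≤ n (`diagAdele_bound`). By induction each value is 0 or f(d_n), and
f(d_n) is taken on an open set containing the class of t = 1. The quotient T_FZ_𝐀\T_𝐀 is compact, so
the toroidal integral is f(d_n) times a positive finite volume, whence f(d_n) = 0. -/

namespace ToroidalForms

/-! ### Compactness of the integers of a complete discretely valued field -/

section Valued

variable {L : Type*} [Field L] [Valued L (WithZero (Multiplicative ℤ))]

theorem le_exp_neg_one_of_lt_one {x : WithZero (Multiplicative ℤ)} (h : x < 1) :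
    x ≤ WithZero.exp (-1) := by
  rw [← WithZero.lt_mul_exp_iff_le WithZero.exp_ne_zero, ← WithZero.exp_add]
  simpa using h

/-- Truncated ϖ-adic expansions with digits in `S`: subtract a digit, divide by ϖ, approximate
again. -/
theorem exists_finite_approx {ϖ : L} (hϖ : Valued.v ϖ = WithZero.exp (-1)) {S : Set L}
    (hS : S.Finite) (hSx : ∀ x : L, Valued.v x ≤ 1 → ∃ s ∈ S, Valued.v (x - s) < 1) (n : ℕ) :
    ∃ T : Set L, T.Finite ∧
      ∀ x : L, Valued.v x ≤ 1 → ∃ t ∈ T, Valued.v (x - t) ≤ WithZero.exp (-(n : ℤ)) := by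
  have hϖ0 : ϖ ≠ 0 := by
    rintro rfl
    exact WithZero.exp_ne_zero (hϖ.symm.trans (map_zero _))
  induction n with
  | zero => exact ⟨{0}, Set.finite_singleton 0, fun x hx => ⟨0, rfl, by simpa using hx⟩⟩
  | succ n ih =>
    obtain ⟨T, hT, hTx⟩ := ih
    refine ⟨Set.image2 (fun s t => s + ϖ * t) S T, hS.image2 _ hT, fun x hx => ?_⟩
    obtain ⟨s, hs, hxs⟩ := hSx x hx
    have h1 : Valued.v ((x - s) / ϖ) ≤ 1 := by
      rw [map_div₀, hϖ]
      exact div_le_one_of_le₀ (le_exp_neg_one_of_lt_one hxs) zero_le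
    obtain ⟨t, ht, hxt⟩ := hTx _ h1
    refine ⟨_, Set.mem_image2_of_mem hs ht, ?_⟩
    have h2 : x - (s + ϖ * t) = ϖ * ((x - s) / ϖ - t) := by
      field_simp
      ring
    rw [h2, map_mul, hϖ, Nat.cast_succ, neg_add_rev, WithZero.exp_add]
    gcongr

theorem exists_ball_subset_of_mem_nhds_zero {s : Set L} (hs : s ∈ nhds (0 : L)) :
    ∃ n : ℕ, ∀ x : L, Valued.v x < WithZero.exp (-(n : ℤ)) → x ∈ s := by
  obtain ⟨γ, hγ⟩ := Valued.mem_nhds_zero.mp hs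
  obtain ⟨n, hn⟩ := WithZero.exists_exp_neg_natCast_lt
    (MonoidWithZeroHom.ValueGroup₀.embedding_unit_pos γ).ne'
  refine ⟨n, fun x hx => hγ ?_⟩
  rw [Set.mem_ofPred_eq, Valuation.restrict_lt_iff_lt_embedding]
  exact hx.trans hn

/-- The integers are closed in a complete field, and the truncated expansions make them totally
bounded. -/
theorem isCompact_integer [CompleteSpace L] {ϖ : L} (hϖ : Valued.v ϖ = WithZero.exp (-1))
    {S : Set L} (hS : S.Finite)
    (hSx : ∀ x : L, Valued.v x ≤ 1 → ∃ s ∈ S, Valued.v (x - s) < 1) :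
    IsCompact {x : L | Valued.v x ≤ 1} := by
  refine isCompact_iff_totallyBounded_isComplete.mpr
    ⟨totallyBounded_iff_subset_finite_iUnion_nhds_zero.mpr fun U hU => ?_,
      (Valued.isClosed_integer L).isComplete⟩
  obtain ⟨n, hn⟩ := exists_ball_subset_of_mem_nhds_zero hU
  obtain ⟨T, hT, hTx⟩ := exists_finite_approx hϖ hS hSx (n + 1)
  refine ⟨T, hT, fun x hx => ?_⟩
  obtain ⟨t, ht, hxt⟩ := hTx x hx
  refine Set.mem_biUnion ht ⟨x - t, hn _ (hxt.trans_lt ?_), by simp⟩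
  exact WithZero.exp_lt_exp.mpr (by lia)

theorem isOpen_setOf_sub_lt_one (x : L) : IsOpen {y : L | Valued.v (x - y) < 1} := by
  have h : IsOpen {y : L | Valued.v y < 1} := by
    have := Valued.isOpen_ball L 1
    simpa only [Valuation.restrict_lt_one_iff] using this
  exact h.preimage (continuous_const.sub continuous_id)

theorem exists_sub_lt_one_of_denseRange {ι : Type*} {f : ι → L} (hf : DenseRange f) (x : L) :
    ∃ i, Valued.v (x - f i) < 1 :=
  hf.exists_mem_open (isOpen_setOf_sub_lt_one x) ⟨x, by simp⟩

end Valued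

/-! ### The place at infinity -/

section Infinity

variable {k : Type u} [Field k]

theorem valued_infinity_algebraMap (y : RatFunc k) :
    Valued.v (algebraMap (RatFunc k) (CompletionAtInfinity k) y) =
      @RatFunc.inftyValuation k _ (Classical.decEq _) y :=
  @Valued.valuedCompletion_apply _ _ _ _ (@RatFunc.inftyValued k _ (Classical.decEq _)) y

theorem denseRange_algebraMap_infinity :
    DenseRange (algebraMap (RatFunc k) (CompletionAtInfinity k)) :=
  @UniformSpace.Completion.denseRange_coe _
    (@RatFunc.inftyValued k _ (Classical.decEq _)).toUniformSpace

instance : CompleteSpace (CompletionAtInfinity k) :=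
  @UniformSpace.Completion.completeSpace _
    (@RatFunc.inftyValued k _ (Classical.decEq _)).toUniformSpace

theorem inftyValuation_polynomial [DecidableEq (RatFunc k)] {p : k[X]} (hp : p ≠ 0) :
    RatFunc.inftyValuation k (algebraMap k[X] (RatFunc k) p) = WithZero.exp (p.natDegree : ℤ) :=
  RatFunc.inftyValuation.polynomial k hp

/-- Division with remainder by the denominator: the proper fraction that is left has negative
degree. -/
theorem exists_polynomial_inftyValuation_sub_lt_one [DecidableEq (RatFunc k)] (y : RatFunc k) :
    ∃ p : k[X], RatFunc.inftyValuation k (y - algebraMap k[X] (RatFunc k) p) < 1 := by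
  refine ⟨y.num /ₘ y.denom, ?_⟩
  have hd : algebraMap k[X] (RatFunc k) y.denom ≠ 0 := by simpa using y.denom_ne_zero
  have h : y - algebraMap k[X] (RatFunc k) (y.num /ₘ y.denom) =
      algebraMap k[X] (RatFunc k) (y.num %ₘ y.denom) / algebraMap k[X] (RatFunc k) y.denom := by
    rw [eq_div_iff hd, sub_mul, Polynomial.modByMonic_eq_sub_mul_div _ y.denom, map_sub, map_mul]
    nth_rw 1 [← RatFunc.num_div_denom y]
    field_simp
  rw [h, map_div₀]
  rcases eq_or_ne (y.num %ₘ y.denom) 0 with h0 | h0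
  · simp [h0]
  · rw [inftyValuation_polynomial h0, inftyValuation_polynomial y.denom_ne_zero,
      ← WithZero.exp_sub, ← WithZero.exp_zero, WithZero.exp_lt_exp, sub_neg, Nat.cast_lt]
    refine Polynomial.natDegree_modByMonic_lt _ y.monic_denom fun h1 => h0 ?_
    rw [h1, Polynomial.modByMonic_one]

/-- The image of a polynomial in the completion at infinity. -/
noncomputable def polyInfinity : k[X] →+* CompletionAtInfinity k :=
  (algebraMap (RatFunc k) (CompletionAtInfinity k)).comp (algebraMap k[X] (RatFunc k))

theorem valued_polyInfinity {p : k[X]} (hp : p ≠ 0) :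
    Valued.v (polyInfinity p) = WithZero.exp (p.natDegree : ℤ) :=
  (valued_infinity_algebraMap _).trans (@inftyValuation_polynomial k _ (Classical.decEq _) p hp)

theorem polynomial_eq_zero_of_valued_lt_one {p : k[X]} (hp : Valued.v (polyInfinity p) < 1) :
    p = 0 := by
  by_contra h
  rw [valued_polyInfinity h, ← WithZero.exp_zero, WithZero.exp_lt_exp] at hp
  lia

theorem polynomial_eq_C_of_valued_le_one {p : k[X]} (hp : Valued.v (polyInfinity p) ≤ 1) :
    ∃ c, p = C c := by
  rcases eq_or_ne p 0 with rfl | h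
  · exact ⟨0, by simp⟩
  · rw [valued_polyInfinity h, ← WithZero.exp_zero, WithZero.exp_le_exp] at hp
    exact ⟨_, Polynomial.eq_C_of_natDegree_eq_zero (by lia)⟩

theorem valued_polyInfinity_C_le_one (c : k) : Valued.v (polyInfinity (C c)) ≤ 1 := by
  rcases eq_or_ne c 0 with rfl | h
  · simp
  · simp [valued_polyInfinity (C_ne_zero.mpr h)]

theorem exists_polynomial_sub_lt_one (x : CompletionAtInfinity k) :
    ∃ p : k[X], Valued.v (x - polyInfinity p) < 1 := by
  obtain ⟨y, hy⟩ := exists_sub_lt_one_of_denseRange denseRange_algebraMap_infinity x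
  obtain ⟨p, hp⟩ := @exists_polynomial_inftyValuation_sub_lt_one k _ (Classical.decEq _) y
  refine ⟨p, ?_⟩
  rw [← valued_infinity_algebraMap, map_sub] at hp
  have := Valued.v.map_add_lt hy hp
  rwa [sub_add_sub_cancel] at this

theorem isCompact_integer_infinity [Finite k] :
    IsCompact {x : CompletionAtInfinity k | Valued.v x ≤ 1} := by
  refine isCompact_integer (ϖ := (polyInfinity X)⁻¹) ?_
    (Set.finite_range fun c : k => polyInfinity (C c)) fun x hx => ?_
  · rw [map_inv₀, valued_polyInfinity X_ne_zero, natDegree_X, ← WithZero.exp_neg, Nat.cast_one]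
  · obtain ⟨p, hp⟩ := exists_polynomial_sub_lt_one x
    have h1 : Valued.v (polyInfinity p) ≤ 1 := by
      have := Valued.v.map_sub_le hx hp.le
      rwa [sub_sub_cancel] at this
    obtain ⟨c, rfl⟩ := polynomial_eq_C_of_valued_le_one h1
    exact ⟨_, ⟨c, rfl⟩, hp⟩

end Infinity

/-! ### The finite places -/

section Finite

open IsDedekindDomain HeightOneSpectrum

variable {k : Type u} [Field k] (v : HeightOneSpectrum k[X])

/-- A generator of the prime ideal of a finite place. -/
noncomputable def primeOf : k[X] := Submodule.IsPrincipal.generator v.asIdeal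

theorem span_primeOf : Ideal.span {primeOf v} = v.asIdeal :=
  Ideal.span_singleton_generator _

theorem primeOf_ne_zero : primeOf v ≠ 0 := by
  intro h
  apply v.ne_bot
  rw [← span_primeOf, h, Ideal.span_singleton_eq_bot]

theorem valuation_primeOf :
    v.valuation (RatFunc k) (algebraMap k[X] (RatFunc k) (primeOf v)) = WithZero.exp (-1) := by
  rw [valuation_of_algebraMap]
  exact intValuation_singleton v (primeOf_ne_zero v) (span_primeOf v).symm

theorem valuation_primeOf_of_ne {w : HeightOneSpectrum k[X]} (h : w ≠ v) :
    w.valuation (RatFunc k) (algebraMap k[X] (RatFunc k) (primeOf v)) = 1 := by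
  rw [valuation_eq_one_iff_notMem]
  intro hm
  have h1 : v.asIdeal ≤ w.asIdeal := by
    rw [← span_primeOf, Ideal.span_singleton_le_iff_mem]
    exact hm
  exact h (HeightOneSpectrum.ext (v.isMaximal.eq_of_le w.isPrime.ne_top h1).symm)

theorem exists_ratFunc_sub_lt_one (x : v.adicCompletion (RatFunc k)) :
    ∃ y : RatFunc k, Valued.v (x - algebraMap _ (v.adicCompletion (RatFunc k)) y) < 1 :=
  exists_sub_lt_one_of_denseRange (denseRange_algebraMap (RatFunc k) v) x

theorem valued_algebraMap (y : RatFunc k) :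
    Valued.v (algebraMap _ (v.adicCompletion (RatFunc k)) y) = v.valuation (RatFunc k) y :=
  valuedAdicCompletion_eq_valuation' v y

theorem finite_quotient [Finite k] : Finite (k[X] ⧸ v.asIdeal) := by
  rw [← span_primeOf]
  have : Module.Finite k (AdjoinRoot (primeOf v)) :=
    (AdjoinRoot.powerBasis (primeOf_ne_zero v)).finite
  exact Module.finite_of_finite k (M := AdjoinRoot (primeOf v))

theorem isCompact_adicCompletionIntegers [Finite k] :
    IsCompact {x : v.adicCompletion (RatFunc k) | Valued.v x ≤ 1} := by
  have := finite_quotient v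
  let r : k[X] ⧸ v.asIdeal → v.adicCompletion (RatFunc k) := fun q =>
    algebraMap (RatFunc k) _ (algebraMap k[X] (RatFunc k) q.out)
  refine isCompact_integer
    ((valued_algebraMap v _).trans (valuation_primeOf v)) (Set.finite_range r) fun x hx => ?_
  obtain ⟨y, hy⟩ := exists_ratFunc_sub_lt_one v x
  have hy1 : v.valuation (RatFunc k) y ≤ 1 := by
    rw [← valued_algebraMap]
    have := Valued.v.map_sub_le hx hy.le
    rwa [sub_sub_cancel] at this
  obtain ⟨a, ha⟩ := exists_valuation_sub_lt_of_integer v hy1 1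
  refine ⟨_, ⟨Ideal.Quotient.mk _ a, rfl⟩, ?_⟩
  have h1 : v.valuation (RatFunc k) (y - algebraMap k[X] (RatFunc k) a) < 1 := by
    rw [Valuation.map_sub_swap]
    exact ha
  have h2 : v.valuation (RatFunc k) (algebraMap k[X] (RatFunc k) a -
      algebraMap k[X] (RatFunc k) (Ideal.Quotient.mk v.asIdeal a).out) < 1 := by
    rw [← map_sub, valuation_lt_one_iff_mem, ← Ideal.Quotient.eq]
    exact (Ideal.Quotient.mk_out _).symm
  have h3 := Valued.v.map_add_lt hy ((valued_algebraMap v _).trans_lt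
    (Valuation.map_add_lt _ h1 h2))
  convert h3 using 2
  simp only [r, map_add, map_sub]
  ring

end Finite

/-! ### Approximation of finite adeles by rational functions -/

section Approximation

open IsDedekindDomain HeightOneSpectrum

variable {k : Type u} [Field k]

/-- Partial fractions. With p = `primeOf v`, Bézout for pⁿ and the prime-to-p part d of the
denominator splits a rational approximation of `x` into a term over d, integral at `v`, and a term
over pⁿ, integral at all other finite places. -/
theorem exists_principal_part (v : HeightOneSpectrum k[X]) (x : v.adicCompletion (RatFunc k)) :
    ∃ y : RatFunc k, Valued.v (x - algebraMap _ (v.adicCompletion (RatFunc k)) y) ≤ 1 ∧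
      ∀ w : HeightOneSpectrum k[X], w ≠ v → w.valuation (RatFunc k) y ≤ 1 := by
  obtain ⟨y, hy⟩ := exists_ratFunc_sub_lt_one v x
  have hp : Prime (primeOf v) := by
    rw [← Ideal.span_singleton_prime (primeOf_ne_zero v), span_primeOf]
    exact v.isPrime
  obtain ⟨d, hd, hnd⟩ := (FiniteMultiplicity.of_not_isUnit hp.not_isUnit
    y.denom_ne_zero).exists_eq_pow_mul_and_not_dvd
  set n := multiplicity (primeOf v) y.denom
  obtain ⟨s, t, hst⟩ : IsCoprime (primeOf v ^ n) d :=
    IsCoprime.pow_left ((Irreducible.coprime_iff_not_dvd hp.irreducible).mpr hnd)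
  let ι := algebraMap k[X] (RatFunc k)
  have hp0 : ι (primeOf v) ≠ 0 := by simpa [ι] using primeOf_ne_zero v
  have hd0 : ι d ≠ 0 := by
    have : d ≠ 0 := by
      rintro rfl
      exact hnd (dvd_zero _)
    simpa [ι] using this
  have h1 : y = ι y.num * ι s / ι d + ι y.num * ι t / ι (primeOf v) ^ n := by
    have h2 : ι s * ι (primeOf v) ^ n + ι t * ι d = 1 := by
      rw [← map_pow, ← map_mul, ← map_mul, ← map_add, hst, map_one]
    nth_rw 1 [← RatFunc.num_div_denom y]
    change ι y.num / ι y.denom = _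
    rw [hd, map_mul, map_pow]
    field_simp
    linear_combination (- ι y.num) * h2
  have hvd : v.valuation (RatFunc k) (ι d) = 1 := by
    rw [valuation_eq_one_iff_notMem, ← span_primeOf, Ideal.mem_span_singleton]
    exact hnd
  refine ⟨ι y.num * ι t / ι (primeOf v) ^ n, ?_, fun w hw => ?_⟩
  · have h3 : Valued.v (algebraMap _ (v.adicCompletion (RatFunc k)) (ι y.num * ι s / ι d)) ≤ 1 := by
      rw [valued_algebraMap, map_div₀, hvd, div_one, ← map_mul]
      exact valuation_le_one v _
    have h4 := Valued.v.map_add_le hy.le h3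
    convert h4 using 2
    have h5 := congrArg (algebraMap _ (v.adicCompletion (RatFunc k))) h1
    rw [map_add] at h5
    linear_combination h5
  · rw [map_div₀, map_pow, valuation_primeOf_of_ne v hw, one_pow, div_one, ← map_mul]
    exact valuation_le_one w _

/-- The principal parts at the finitely many poles of `x` are added up; each is integral at the
other finite places. -/
theorem exists_ratFunc_sub_integral (x : FiniteAdeleRing k[X] (RatFunc k)) :
    ∃ y : RatFunc k, ∀ v : HeightOneSpectrum k[X],
      Valued.v ((x - algebraMap _ (FiniteAdeleRing k[X] (RatFunc k)) y) v) ≤ 1 := by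
  classical
  choose y hy hyw using fun v => exists_principal_part v (x v)
  have hfin : {v | ¬ x v ∈ v.adicCompletionIntegers (RatFunc k)}.Finite := x.2
  refine ⟨∑ v ∈ hfin.toFinset, y v, fun w => ?_⟩
  change Valued.v (x w - algebraMap (RatFunc k) (w.adicCompletion (RatFunc k))
    (∑ v ∈ hfin.toFinset, y v)) ≤ 1
  have hother : ∀ s : Finset (HeightOneSpectrum k[X]), w ∉ s →
      Valued.v (algebraMap _ (w.adicCompletion (RatFunc k)) (∑ v ∈ s, y v)) ≤ 1 := fun s hs => by
    rw [valued_algebraMap]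
    refine Valuation.map_sum_le _ fun v hv => hyw v w ?_
    rintro rfl
    exact hs hv
  by_cases hw : w ∈ hfin.toFinset
  · rw [← Finset.add_sum_erase _ _ hw, map_add, ← sub_sub]
    exact Valued.v.map_sub_le (hy w) (hother _ (Finset.notMem_erase w _))
  · refine Valued.v.map_sub_le ?_ (hother _ hw)
    have : x w ∈ w.adicCompletionIntegers (RatFunc k) := by simpa using hw
    exact this

/-- Class number one: every prime of k[X] has a generator, and a product of powers of these realizes
any finite set of orders. -/
theorem exists_ratFunc_valued_eq (x : (FiniteAdeleRing k[X] (RatFunc k))ˣ) :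
    ∃ y : RatFunc k, y ≠ 0 ∧ ∀ v : HeightOneSpectrum k[X],
      Valued.v (x.val v) = v.valuation (RatFunc k) y := by
  classical
  obtain ⟨h0, hfin⟩ := FiniteAdeleRing.isUnit_iff.mp x.isUnit
  have hfin' : {v | ¬ Valued.v (x.val v) = 1}.Finite := hfin
  refine ⟨∏ v ∈ hfin'.toFinset, algebraMap k[X] (RatFunc k) (primeOf v) ^
    (-WithZero.log (Valued.v (x.val v))), ?_, fun w => ?_⟩
  · refine Finset.prod_ne_zero_iff.mpr fun v _ => zpow_ne_zero _ ?_
    simpa using primeOf_ne_zero v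
  · have hx : Valued.v (x.val w) ≠ 0 := (Valuation.ne_zero_iff _).mpr (h0 w)
    rw [map_prod, Finset.prod_eq_single w]
    · rw [map_zpow₀, valuation_primeOf, ← WithZero.exp_zsmul]
      simp [WithZero.exp_log hx]
    · intro v _ hv
      rw [map_zpow₀, valuation_primeOf_of_ne v hv.symm, one_zpow]
    · intro hw
      have : Valued.v (x.val w) = 1 := by simpa using hw
      simp [this]

theorem exists_polynomial_of_forall_valuation_le_one {y : RatFunc k}
    (hy : ∀ v : HeightOneSpectrum k[X], v.valuation (RatFunc k) y ≤ 1) :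
    ∃ p : k[X], algebraMap k[X] (RatFunc k) p = y :=
  mem_integers_of_valuation_le_one _ y hy

end Approximation

/-! ### Integral and triangular matrices -/

section Matrices

variable {R : Type*} [CommRing R]

/-- The subgroup of `GL₂(R)` of the matrices which are integral with respect to a subring. -/
def integralGL (S : Subring R) : Subgroup (GL (Fin 2) R) where
  carrier := {g | (∀ i j, g.val i j ∈ S) ∧ ∀ i j, g⁻¹.val i j ∈ S}
  mul_mem' := by
    rintro g h ⟨hg, hg'⟩ ⟨hh, hh'⟩
    refine ⟨fun i j => ?_, fun i j => ?_⟩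
    · rw [Units.val_mul, Matrix.mul_apply]
      exact sum_mem fun l _ => mul_mem (hg i l) (hh l j)
    · rw [mul_inv_rev, Units.val_mul, Matrix.mul_apply]
      exact sum_mem fun l _ => mul_mem (hh' i l) (hg' l j)
  one_mem' := by
    have h : ∀ i j, (1 : GL (Fin 2) R).val i j ∈ S := fun i j => by
      rw [Units.val_one, Matrix.one_apply]
      split_ifs
      exacts [one_mem S, zero_mem S]
    exact ⟨h, by simpa only [inv_one] using h⟩
  inv_mem' := by
    rintro g ⟨hg, hg'⟩
    exact ⟨hg', by simpa only [inv_inv] using hg⟩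

theorem range_map_subtype (S : Subring R) :
    (Matrix.GeneralLinearGroup.map (n := Fin 2) S.subtype).range = integralGL S := by
  ext g
  constructor
  · rintro ⟨h, rfl⟩
    exact ⟨fun i j => (h.val i j).2, fun i j => (h⁻¹.val i j).2⟩
  · rintro ⟨hg, hg'⟩
    let a : Matrix (Fin 2) (Fin 2) S := Matrix.of fun i j => ⟨_, hg i j⟩
    let b : Matrix (Fin 2) (Fin 2) S := Matrix.of fun i j => ⟨_, hg' i j⟩
    have ha : S.subtype.mapMatrix a = g.val := rfl
    have hb : S.subtype.mapMatrix b = g⁻¹.val := rfl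
    have hinj : Function.Injective (S.subtype.mapMatrix (m := Fin 2)) :=
      Matrix.map_injective Subtype.val_injective
    refine ⟨⟨a, b, hinj ?_, hinj ?_⟩, Units.ext ha⟩
    · rw [map_mul, ha, hb, map_one, Units.mul_inv]
    · rw [map_mul, ha, hb, map_one, Units.inv_mul]

/-- The invertible upper triangular matrix with diagonal `(a, d)` and corner `b`. -/
def upperTriangular (a d : Rˣ) (b : R) : GL (Fin 2) R where
  val := !![a.val, b; 0, d.val]
  inv := !![a⁻¹.val, -(a⁻¹.val * b * d⁻¹.val); 0, d⁻¹.val]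
  val_inv := by
    ext i j
    fin_cases i <;> fin_cases j <;> simp [← mul_assoc]
  inv_val := by
    ext i j
    fin_cases i <;> fin_cases j <;> simp

/-- The matrix with rows `(x, y)` and `(z, w)` of determinant one. -/
def ofDetOne (x y z w : R) (h : x * w - y * z = 1) : GL (Fin 2) R where
  val := !![x, y; z, w]
  inv := !![w, -y; -z, x]
  val_inv := by
    ext i j
    fin_cases i <;> fin_cases j <;> simp <;> grind
  inv_val := by
    ext i j
    fin_cases i <;> fin_cases j <;> simp <;> grind

theorem val_upperTriangular (a d : Rˣ) (b : R) :
    (upperTriangular a d b).val = !![a.val, b; 0, d.val] := rfl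

theorem val_inv_upperTriangular (a d : Rˣ) (b : R) : (upperTriangular a d b)⁻¹.val =
    !![a⁻¹.val, -(a⁻¹.val * b * d⁻¹.val); 0, d⁻¹.val] := rfl

theorem val_ofDetOne (x y z w : R) (h : x * w - y * z = 1) :
    (ofDetOne x y z w h).val = !![x, y; z, w] := rfl

theorem val_inv_ofDetOne (x y z w : R) (h : x * w - y * z = 1) :
    (ofDetOne x y z w h)⁻¹.val = !![w, -y; -z, x] := rfl

theorem ofDetOne_mem {S : Subring R} {x y z w : R} (h : x * w - y * z = 1) (hx : x ∈ S)
    (hy : y ∈ S) (hz : z ∈ S) (hw : w ∈ S) : ofDetOne x y z w h ∈ integralGL S := by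
  refine ⟨fun i j => ?_, fun i j => ?_⟩
  · fin_cases i <;> fin_cases j <;> simpa [val_ofDetOne]
  · rw [val_inv_ofDetOne]
    fin_cases i <;> fin_cases j <;> simpa

theorem upperTriangular_mem {S : Subring R} {a d : Rˣ} {b : R} (ha : a.val ∈ S)
    (ha' : a⁻¹.val ∈ S) (hd : d.val ∈ S) (hd' : d⁻¹.val ∈ S) (hb : b ∈ S) :
    upperTriangular a d b ∈ integralGL S := by
  refine ⟨fun i j => ?_, fun i j => ?_⟩
  · fin_cases i <;> fin_cases j <;> simp [val_upperTriangular, *]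
  · have := mul_mem (mul_mem ha' hb) hd'
    rw [val_inv_upperTriangular]
    fin_cases i <;> fin_cases j <;> simp [*]

theorem exists_eq_upperTriangular (g : GL (Fin 2) R) (hg : g.val 1 0 = 0) :
    ∃ a d : Rˣ, g = upperTriangular a d (g.val 0 1) := by
  have h1 := congrFun₂ g.mul_inv
  have h2 := congrFun₂ g.inv_mul
  simp only [Matrix.mul_apply, Fin.sum_univ_two] at h1 h2
  have hd : g.val 1 1 * g.inv 1 1 = 1 := by simpa [hg] using h1 1 1
  have ha : g.inv 0 0 * g.val 0 0 = 1 := by simpa [hg] using h2 0 0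
  refine ⟨⟨g.val 0 0, g.inv 0 0, by rw [mul_comm, ha], ha⟩,
    ⟨g.val 1 1, g.inv 1 1, hd, by rw [mul_comm, hd]⟩, ?_⟩
  ext i j
  fin_cases i <;> fin_cases j <;> simp [val_upperTriangular, hg]

end Matrices

/-! ### Iwasawa decomposition and the finite part of G_𝐀 -/

section Iwasawa

/-- One of c/d and d/c is integral, so one entry of the row (c, d) clears the other by an integral
column operation of determinant one. -/
theorem exists_column_operation {L : Type*} [Field L] [Valued L (WithZero (Multiplicative ℤ))]
    (c d : L) : ∃ x y z w : L, Valued.v x ≤ 1 ∧ Valued.v y ≤ 1 ∧ Valued.v z ≤ 1 ∧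
      Valued.v w ≤ 1 ∧ x * w - y * z = 1 ∧ c * x + d * z = 0 := by
  rcases le_or_gt (Valued.v c) (Valued.v d) with h | h
  · refine ⟨1, 0, -(c / d), 1, by simp, by simp, ?_, by simp, by simp, ?_⟩
    · rw [Valuation.map_neg, map_div₀]
      exact div_le_one_of_le₀ h zero_le
    · rcases eq_or_ne d 0 with rfl | hd
      · have : c = 0 := by simpa using h
        simp [this]
      · field_simp
        ring
  · have hc : c ≠ 0 := by
      rintro rfl
      simp at h
    refine ⟨-(d / c), -1, 1, 0, ?_, by simp, by simp, by simp, by simp, ?_⟩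
    · rw [Valuation.map_neg, map_div₀]
      exact div_le_one_of_le₀ h.le zero_le
    · field_simp
      ring

end Iwasawa

section Finite

open IsDedekindDomain HeightOneSpectrum

variable (k : Type u) [Field k]

/-- The ring of integral finite adeles. -/
def finiteIntegers : Subring (FiniteAdeleRing k[X] (RatFunc k)) where
  carrier := {a | ∀ v : HeightOneSpectrum k[X], a v ∈ v.adicCompletionIntegers (RatFunc k)}
  mul_mem' := fun ha hb v => mul_mem (ha v) (hb v)
  one_mem' := fun v => one_mem (v.adicCompletionIntegers (RatFunc k))
  add_mem' := fun ha hb v => add_mem (ha v) (hb v)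
  zero_mem' := fun v => zero_mem (v.adicCompletionIntegers (RatFunc k))
  neg_mem' := fun ha v => neg_mem (ha v)

variable {k}

theorem mem_finiteIntegers {a : FiniteAdeleRing k[X] (RatFunc k)} :
    a ∈ finiteIntegers k ↔ ∀ v : HeightOneSpectrum k[X], Valued.v (a v) ≤ 1 := Iff.rfl

theorem exists_iwasawa_finite (h : GL (Fin 2) (FiniteAdeleRing k[X] (RatFunc k))) :
    ∃ κ ∈ integralGL (finiteIntegers k), (h * κ).val 1 0 = 0 := by
  choose x y z w hx hy hz hw hdet hcol using fun v : HeightOneSpectrum k[X] =>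
    exists_column_operation (h.val 1 0 v) (h.val 1 1 v)
  have mk : ∀ a : (v : HeightOneSpectrum k[X]) → v.adicCompletion (RatFunc k),
      (∀ v, Valued.v (a v) ≤ 1) → ∃ a' : FiniteAdeleRing k[X] (RatFunc k), ∀ v, a' v = a v :=
    fun a ha => ⟨⟨a, Filter.Eventually.of_forall ha⟩, fun v => rfl⟩
  obtain ⟨x', hx'⟩ := mk x hx
  obtain ⟨y', hy'⟩ := mk y hy
  obtain ⟨z', hz'⟩ := mk z hz
  obtain ⟨w', hw'⟩ := mk w hw
  have hdet' : x' * w' - y' * z' = 1 := by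
    refine FiniteAdeleRing.ext _ fun v => ?_
    change x' v * w' v - y' v * z' v = 1
    rw [hx', hy', hz', hw', hdet]
  refine ⟨ofDetOne x' y' z' w' hdet', ofDetOne_mem hdet' (mem_finiteIntegers.mpr fun v => (hx' v).symm ▸ hx v)
    (mem_finiteIntegers.mpr fun v => (hy' v).symm ▸ hy v) (mem_finiteIntegers.mpr fun v => (hz' v).symm ▸ hz v)
    (mem_finiteIntegers.mpr fun v => (hw' v).symm ▸ hw v), ?_⟩
  rw [Units.val_mul, Matrix.mul_apply, Fin.sum_univ_two, val_ofDetOne]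
  refine FiniteAdeleRing.ext _ fun v => ?_
  change h.val 1 0 v * x' v + h.val 1 1 v * z' v = 0
  rw [hx', hz', hcol]

theorem exists_unit_decomposition (a : (FiniteAdeleRing k[X] (RatFunc k))ˣ) :
    ∃ (α : (RatFunc k)ˣ) (u : (FiniteAdeleRing k[X] (RatFunc k))ˣ),
      u.val ∈ finiteIntegers k ∧ u⁻¹.val ∈ finiteIntegers k ∧
        a = Units.map (algebraMap (RatFunc k) (FiniteAdeleRing k[X] (RatFunc k))).toMonoidHom α * u := by
  obtain ⟨y, hy0, hy⟩ := exists_ratFunc_valued_eq a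
  set ι := Units.map (algebraMap (RatFunc k) (FiniteAdeleRing k[X] (RatFunc k))).toMonoidHom
  have key : ∀ v, Valued.v (((ι (Units.mk0 y hy0))⁻¹ * a).val v) = 1 := fun v => by
    have h1 : (ι (Units.mk0 y hy0)).val * ((ι (Units.mk0 y hy0))⁻¹ * a).val = a.val := by
      rw [← Units.val_mul, mul_inv_cancel_left]
    have h2 : algebraMap _ (v.adicCompletion (RatFunc k)) y *
        ((ι (Units.mk0 y hy0))⁻¹ * a).val v = a.val v :=
      congrArg (fun t : FiniteAdeleRing k[X] (RatFunc k) => t v) h1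
    have h3 := congrArg Valued.v h2
    rw [map_mul, valued_algebraMap, hy] at h3
    exact mul_left_cancel₀ ((Valuation.ne_zero_iff _).mpr hy0) (h3.trans (mul_one _).symm)
  refine ⟨Units.mk0 y hy0, (ι (Units.mk0 y hy0))⁻¹ * a, mem_finiteIntegers.mpr fun v => (key v).le,
    mem_finiteIntegers.mpr fun v => ?_,
    (mul_inv_cancel_left _ _).symm⟩
  set u := (ι (Units.mk0 y hy0))⁻¹ * a
  have h1 : u.val v * u⁻¹.val v = 1 :=
    congrArg (fun t : FiniteAdeleRing k[X] (RatFunc k) => t v) u.mul_inv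
  have h2 := congrArg Valued.v h1
  rw [map_mul, key, one_mul, map_one] at h2
  exact h2.le

theorem upperTriangular_mul {R : Type*} [CommRing R] (a d a' d' : Rˣ) (b b' : R) :
    upperTriangular a d b * upperTriangular a' d' b' =
      upperTriangular (a * a') (d * d') (a * b' + b * d') := by
  ext i j
  fin_cases i <;> fin_cases j <;> simp [val_upperTriangular, Matrix.mul_apply]

theorem map_upperTriangular {R S : Type*} [CommRing R] [CommRing S] (f : R →+* S) (a d : Rˣ)
    (b : R) : Matrix.GeneralLinearGroup.map f (upperTriangular a d b) =
      upperTriangular (Units.map f.toMonoidHom a) (Units.map f.toMonoidHom d) (f b) := by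
  ext i j
  fin_cases i <;> fin_cases j <;> simp [val_upperTriangular]

/-- After the Iwasawa decomposition, the diagonal entries are rational times unit by class number
one, and the corner is rational plus integral by principal parts. -/
theorem exists_finite_decomposition (h : GL (Fin 2) (FiniteAdeleRing k[X] (RatFunc k))) :
    ∃ γ : GL (Fin 2) (RatFunc k), ∃ κ ∈ integralGL (finiteIntegers k),
      h = Matrix.GeneralLinearGroup.map
        (algebraMap (RatFunc k) (FiniteAdeleRing k[X] (RatFunc k))) γ * κ := by
  obtain ⟨κ, hκ, h0⟩ := exists_iwasawa_finite h
  obtain ⟨a, d, had⟩ := exists_eq_upperTriangular _ h0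
  obtain ⟨α, u, hu, hu', rfl⟩ := exists_unit_decomposition a
  obtain ⟨δ, w, hw, hw', rfl⟩ := exists_unit_decomposition d
  set ι := algebraMap (RatFunc k) (FiniteAdeleRing k[X] (RatFunc k))
  set b := (h * κ).val 0 1
  set α' := Units.map ι.toMonoidHom α
  -- The corner is normalized by the rational diagonal factor on the left and the unit one on the
  -- right before its rational part is split off.
  obtain ⟨β, hβ⟩ := exists_ratFunc_sub_integral (α'⁻¹.val * b * w⁻¹.val)
  have hβ' : α'⁻¹.val * b * w⁻¹.val - ι β ∈ finiteIntegers k :=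
    mem_finiteIntegers.mpr hβ
  refine ⟨upperTriangular α δ (α * β),
    upperTriangular u w ((α'⁻¹.val * b * w⁻¹.val - ι β) * w) * κ⁻¹, ?_, ?_⟩
  · exact mul_mem (upperTriangular_mem hu hu' hw hw' (mul_mem hβ' hw)) (inv_mem hκ)
  · rw [map_upperTriangular, ← mul_assoc, upperTriangular_mul, eq_mul_inv_iff_mul_eq, had]
    congr 1
    have h1 : ι α = α'.val := rfl
    rw [map_mul, h1]
    linear_combination (-b * w⁻¹.val * w) * α'.mul_inv - b * w.inv_mul

end Finite

/-! ### Reduction theory for GL₂(k[X]) at infinity -/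

section Infinity

variable {k : Type u} [Field k]

variable (k) in
/-- The ring of integers of the completion at infinity. -/
noncomputable abbrev infinityIntegers : Subring (CompletionAtInfinity k) :=
  (Valued.v (R := CompletionAtInfinity k)).integer

variable (k) in
/-- The coordinate `X` as a unit of the completion at infinity. -/
noncomputable def unitX : (CompletionAtInfinity k)ˣ :=
  Units.mk0 (polyInfinity X) fun h => by
    have h1 := valued_polyInfinity (k := k) X_ne_zero
    rw [h, map_zero] at h1
    exact WithZero.exp_ne_zero h1.symm

theorem valued_unitX_zpow (m : ℤ) : Valued.v (unitX k ^ m).val = WithZero.exp m := by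
  rw [Units.val_zpow_eq_zpow_val, map_zpow₀]
  simp [unitX, valued_polyInfinity X_ne_zero, ← WithZero.exp_zsmul]

/-- The matrix `diag(Xⁿ, 1)` over the completion at infinity. -/
noncomputable def diagInfinity (n : ℤ) : GL (Fin 2) (CompletionAtInfinity k) :=
  upperTriangular (unitX k ^ n) 1 0

/-- The double coset relation describing reduction theory at infinity. -/
def IsReducible (g : GL (Fin 2) (CompletionAtInfinity k)) : Prop :=
  ∃ (δ : GL (Fin 2) k[X]) (j : ℕ), ∃ κ ∈ integralGL (infinityIntegers k),
    ∃ z : (CompletionAtInfinity k)ˣ, g = Matrix.GeneralLinearGroup.map polyInfinity δ *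
      diagInfinity j * κ * upperTriangular z z 0

theorem upperTriangular_scalar_comm {R : Type*} [CommRing R] (z : Rˣ) (g : GL (Fin 2) R) :
    upperTriangular z z 0 * g = g * upperTriangular z z 0 := by
  ext i j
  fin_cases i <;> fin_cases j <;> simp [val_upperTriangular, Matrix.mul_apply, mul_comm]

theorem IsReducible.of_mul {g g' κ : GL (Fin 2) (CompletionAtInfinity k)} (hg : IsReducible g)
    (δ : GL (Fin 2) k[X]) (hκ : κ ∈ integralGL (infinityIntegers k))
    (z : (CompletionAtInfinity k)ˣ)
    (h : g' = Matrix.GeneralLinearGroup.map polyInfinity δ * g * κ * upperTriangular z z 0) :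
    IsReducible g' := by
  obtain ⟨δ', j, κ', hκ', z', rfl⟩ := hg
  refine ⟨δ * δ', j, κ' * κ, mul_mem hκ' hκ, z' * z, ?_⟩
  have h1 : (upperTriangular (z' * z) (z' * z) 0 : GL (Fin 2) (CompletionAtInfinity k)) =
      upperTriangular z' z' 0 * upperTriangular z z 0 := by
    rw [upperTriangular_mul]
    simp
  rw [h, map_mul, h1]
  simp only [mul_assoc]
  rw [← mul_assoc (upperTriangular z' z' 0) κ, upperTriangular_scalar_comm, mul_assoc]

end Infinity

section Infinity

variable {k : Type u} [Field k]

theorem isReducible_diagInfinity (n : ℕ) : IsReducible (k := k) (diagInfinity n) :=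
  ⟨1, n, 1, one_mem _, 1, by
    have : (upperTriangular 1 1 0 : GL (Fin 2) (CompletionAtInfinity k)) = 1 := by
      ext i j
      fin_cases i <;> fin_cases j <;> simp [val_upperTriangular]
    simp [this]⟩

theorem polynomial_translation (m : ℤ) (b : CompletionAtInfinity k) :
    ∃ b', Valued.v b' < 1 ∧ (IsReducible (upperTriangular (unitX k ^ m) 1 b') →
      IsReducible (upperTriangular (unitX k ^ m) 1 b)) := by
  obtain ⟨p, hp⟩ := exists_polynomial_sub_lt_one b
  refine ⟨_, hp, fun h => h.of_mul (upperTriangular 1 1 p) (one_mem _) 1 ?_⟩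
  rw [map_upperTriangular, upperTriangular_mul, mul_one, upperTriangular_mul]
  simp

/-- The Weyl element of `GL₂`. -/
def weyl (R : Type*) [CommRing R] : GL (Fin 2) R := ofDetOne 0 (-1) 1 0 (by ring)

theorem val_weyl (R : Type*) [CommRing R] : (weyl R).val = !![0, -1; 1, 0] := rfl

theorem val_inv_weyl (R : Type*) [CommRing R] : (weyl R)⁻¹.val = !![0, 1; -1, 0] := by
  rw [weyl, val_inv_ofDetOne, neg_neg]

theorem map_weyl {R S : Type*} [CommRing R] [CommRing S] (f : R →+* S) :
    Matrix.GeneralLinearGroup.map f (weyl R) = weyl S := by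
  ext i j
  fin_cases i <;> fin_cases j <;> simp [weyl, val_ofDetOne]

theorem weyl_mem {R : Type*} [CommRing R] (S : Subring R) : weyl R ∈ integralGL S :=
  ofDetOne_mem _ (zero_mem S) (neg_mem (one_mem S)) (one_mem S) (zero_mem S)

theorem isReducible_diagInfinity_int (n : ℤ) : IsReducible (k := k) (diagInfinity n) := by
  obtain ⟨m, rfl | rfl⟩ := n.eq_nat_or_neg
  · exact isReducible_diagInfinity m
  · refine (isReducible_diagInfinity m).of_mul (weyl _) (inv_mem (weyl_mem _))
      (unitX k ^ (-(m : ℤ))) ?_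
    rw [map_weyl]
    ext i j
    simp only [Units.val_mul]
    rw [val_weyl, val_inv_weyl, diagInfinity, diagInfinity, val_upperTriangular,
      val_upperTriangular, val_upperTriangular]
    fin_cases i <;> fin_cases j <;> simp [Matrix.mul_apply]

theorem isReducible_upperTriangular_of_le (m : ℤ) (b : CompletionAtInfinity k)
    (hb : Valued.v b ≤ WithZero.exp m) : IsReducible (upperTriangular (unitX k ^ m) 1 b) := by
  refine (isReducible_diagInfinity_int m).of_mul 1
    (upperTriangular_mem (a := 1) (d := 1) (b := (unitX k ^ m)⁻¹.val * b) ?_ ?_ ?_ ?_ ?_) 1 ?_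
  · exact one_mem _
  · exact one_mem _
  · exact one_mem _
  · exact one_mem _
  · rw [Valuation.mem_integer_iff, map_mul, ← zpow_neg, valued_unitX_zpow]
    calc _ ≤ WithZero.exp (-m) * WithZero.exp m := by gcongr
      _ = 1 := by rw [← WithZero.exp_add]; simp
  · rw [map_one, one_mul, diagInfinity, upperTriangular_mul, upperTriangular_mul, mul_one, mul_one,
      mul_one, mul_one, mul_zero, zero_add, Units.val_one, mul_one, zero_mul, add_zero,
      Units.mul_inv_cancel_left]

/-- A continued fraction algorithm. A polynomial translation gives |b| < 1. If |b| ≤ |X^m|, a column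
operation clears b; this always happens for m ≥ 0. Otherwise |b| = exp r with r < 0, and the Weyl
element replaces b by -1/b and m by m - 2r, so the exponent rises by at least two. -/
theorem isReducible_upperTriangular_X (s : ℕ) : ∀ (m : ℤ) (_ : -m ≤ s)
    (b : CompletionAtInfinity k), IsReducible (upperTriangular (unitX k ^ m) 1 b) := by
  induction s with
  | zero =>
    intro m hm b
    obtain ⟨b', hb', h⟩ := polynomial_translation m b
    exact h (isReducible_upperTriangular_of_le m b' (hb'.le.trans
      (WithZero.exp_zero.symm.trans_le (WithZero.exp_le_exp.mpr (by simpa using hm)))))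
  | succ s ih =>
    intro m hm b
    obtain ⟨b', hb', h⟩ := polynomial_translation m b
    refine h ?_
    rcases le_or_gt (Valued.v b') (WithZero.exp m) with hle | hlt
    · exact isReducible_upperTriangular_of_le m b' hle
    have hb0 : b' ≠ 0 := by
      rintro rfl
      simp at hlt
    obtain ⟨r, hr⟩ : ∃ r : ℤ, Valued.v b' = WithZero.exp r :=
      ⟨_, (WithZero.exp_log ((Valuation.ne_zero_iff _).mpr hb0)).symm⟩
    rw [hr, WithZero.exp_lt_exp] at hlt
    rw [hr, ← WithZero.exp_zero, WithZero.exp_lt_exp] at hb'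
    set β := Units.mk0 b' hb0
    -- The discrepancy between X^(2r) and β² is a unit, which can be absorbed into the integral
    -- matrix.
    set u : (CompletionAtInfinity k)ˣ := unitX k ^ (2 * r) * β⁻¹ ^ 2
    have hu : Valued.v u.val = 1 := by
      rw [Units.val_mul, map_mul, valued_unitX_zpow, Units.val_pow_eq_pow_val, map_pow,
        Units.val_inv_eq_inv_val, map_inv₀]
      change _ * (Valued.v b')⁻¹ ^ 2 = 1
      rw [hr, ← WithZero.exp_neg, ← WithZero.exp_nsmul, ← WithZero.exp_add]
      simp
    have hu' : Valued.v u⁻¹.val = 1 := by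
      rw [Units.val_inv_eq_inv_val, map_inv₀, hu, inv_one]
    refine (ih (m - 2 * r) (by push_cast at hm; lia) (-β⁻¹.val)).of_mul (weyl _)
      (κ := upperTriangular (-u) (-1) 0 * ofDetOne 1 0 ((unitX k ^ m).val * β⁻¹.val) 1 (by ring)) ?_ β ?_
    · refine mul_mem (upperTriangular_mem ?_ ?_ (neg_mem (one_mem _)) ?_ (zero_mem _))
        (ofDetOne_mem _ (one_mem _) (zero_mem _) ?_ (one_mem _))
      · exact neg_mem (s := infinityIntegers k) hu.le
      · rw [inv_neg]
        exact neg_mem (s := infinityIntegers k) hu'.le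
      · rw [inv_neg, inv_one]
        exact neg_mem (one_mem (infinityIntegers k))
      rw [Valuation.mem_integer_iff, map_mul, valued_unitX_zpow, Units.val_inv_eq_inv_val, map_inv₀]
      change _ * (Valued.v b')⁻¹ ≤ 1
      rw [hr, ← WithZero.exp_neg, ← WithZero.exp_add, ← WithZero.exp_zero, WithZero.exp_le_exp]
      lia
    · have hX : (unitX k ^ (m - 2 * r)).val * u.val * β.val ^ 2 = (unitX k ^ m).val := by
        rw [← Units.val_pow_eq_pow_val, ← Units.val_mul, ← Units.val_mul, mul_assoc,
          mul_assoc (unitX k ^ (2 * r)), ← mul_pow, inv_mul_cancel, one_pow, mul_one, ← zpow_add,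
          sub_add_cancel]
      have hβ : β⁻¹.val * b' = 1 := β.inv_mul
      rw [map_weyl]
      ext i j
      simp only [Units.val_mul]
      rw [val_weyl, val_ofDetOne, val_upperTriangular, val_upperTriangular,
        val_upperTriangular, val_upperTriangular]
      simp only [Matrix.mul_fin_two]
      fin_cases i <;> fin_cases j <;> simp
      · rfl
      · rw [Units.val_zpow_eq_zpow_val, Units.val_zpow_eq_zpow_val] at hX
        rw [← hX]
        have := β.ne_zero
        field_simp
        ring

theorem isReducible_infinity (g : GL (Fin 2) (CompletionAtInfinity k)) : IsReducible g := by
  obtain ⟨x, y, z, w, hx, hy, hz, hw, hdet, hcol⟩ :=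
    exists_column_operation (g.val 1 0) (g.val 1 1)
  have h0 : (g * ofDetOne x y z w hdet).val 1 0 = 0 := by
    rw [Units.val_mul, Matrix.mul_apply, Fin.sum_univ_two, val_ofDetOne]
    exact hcol
  obtain ⟨a, d, had⟩ := exists_eq_upperTriangular _ h0
  set b := (g * ofDetOne x y z w hdet).val 0 1
  obtain ⟨r, hr⟩ : ∃ r : ℤ, Valued.v (a * d⁻¹).val = WithZero.exp r :=
    ⟨_, (WithZero.exp_log ((Valuation.ne_zero_iff _).mpr (a * d⁻¹).ne_zero)).symm⟩
  set u := (unitX k ^ r)⁻¹ * (a * d⁻¹) with hudef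
  have hu : Valued.v u.val = 1 := by
    rw [Units.val_mul, map_mul, ← zpow_neg, valued_unitX_zpow, hr, ← WithZero.exp_add]
    simp
  have hu' : Valued.v u⁻¹.val = 1 := by
    rw [Units.val_inv_eq_inv_val, map_inv₀, hu, inv_one]
  refine (isReducible_upperTriangular_X (-r).toNat r (by lia) (b * d⁻¹.val)).of_mul 1
    (mul_mem (upperTriangular_mem (d := 1) hu.le hu'.le (one_mem _) (one_mem _) (zero_mem _))
      (inv_mem (ofDetOne_mem hdet hx hy hz hw))) d ?_
  rw [map_one, one_mul, mul_assoc, mul_assoc, ← upperTriangular_scalar_comm, ← mul_assoc,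
    ← mul_assoc, eq_mul_inv_iff_mul_eq, had, upperTriangular_mul, upperTriangular_mul, hudef]
  congr 1
  · rw [mul_inv_cancel_left, inv_mul_cancel_right]
  · rw [mul_one, one_mul]
  · rw [mul_zero, mul_zero, zero_add, zero_add, Units.val_one, mul_one,
      Units.inv_mul_cancel_right]

end Infinity

/-! ### Representatives of the adelic double cosets -/

section Adelic

open IsDedekindDomain HeightOneSpectrum

/-- The matrix over a product ring with given components. -/
def pairGL {R S : Type*} [CommRing R] [CommRing S] (g : GL (Fin 2) R) (h : GL (Fin 2) S) :
    GL (Fin 2) (R × S) where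
  val := Matrix.of fun i j => (g.val i j, h.val i j)
  inv := Matrix.of fun i j => (g⁻¹.val i j, h⁻¹.val i j)
  val_inv := by
    have hg := congrFun₂ g.mul_inv
    have hh := congrFun₂ h.mul_inv
    refine Matrix.ext fun i j => Prod.ext ((Eq.trans ?_ (hg i j)).trans ?_) ((Eq.trans ?_ (hh i j)).trans ?_)
    all_goals fin_cases i <;> fin_cases j <;> simp [Matrix.mul_apply]
  inv_val := by
    have hg := congrFun₂ g.inv_mul
    have hh := congrFun₂ h.inv_mul
    refine Matrix.ext fun i j => Prod.ext ((Eq.trans ?_ (hg i j)).trans ?_) ((Eq.trans ?_ (hh i j)).trans ?_)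
    all_goals fin_cases i <;> fin_cases j <;> simp [Matrix.mul_apply]

/-- The first component of a matrix over a product ring. -/
def fstGL (R S : Type*) [CommRing R] [CommRing S] : GL (Fin 2) (R × S) →* GL (Fin 2) R :=
  Matrix.GeneralLinearGroup.map (RingHom.fst R S)

/-- The second component of a matrix over a product ring. -/
def sndGL (R S : Type*) [CommRing R] [CommRing S] : GL (Fin 2) (R × S) →* GL (Fin 2) S :=
  Matrix.GeneralLinearGroup.map (RingHom.snd R S)

section

variable {R S : Type*} [CommRing R] [CommRing S]

@[simp] theorem fstGL_pairGL (g : GL (Fin 2) R) (h : GL (Fin 2) S) :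
    fstGL R S (pairGL g h) = g := by
  ext i j
  rfl

@[simp] theorem sndGL_pairGL (g : GL (Fin 2) R) (h : GL (Fin 2) S) :
    sndGL R S (pairGL g h) = h := by
  ext i j
  rfl

theorem ext_fstGL_sndGL {g h : GL (Fin 2) (R × S)} (h1 : fstGL R S g = fstGL R S h)
    (h2 : sndGL R S g = sndGL R S h) : g = h := by
  refine Units.ext (Matrix.ext fun i j => Prod.ext ?_ ?_)
  · exact congrArg (fun g : GL (Fin 2) R => g.val i j) h1
  · exact congrArg (fun g : GL (Fin 2) S => g.val i j) h2

end

variable {k : Type u} [Field k]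

theorem maximalCompact_eq : maximalCompact k = integralGL (integralAdeles k) :=
  range_map_subtype _

theorem mem_maximalCompact_iff {g : GLAdele k} : g ∈ maximalCompact k ↔
    fstGL _ _ g ∈ integralGL (infinityIntegers k) ∧
      sndGL _ _ g ∈ integralGL (finiteIntegers k) := by
  rw [maximalCompact_eq]
  exact ⟨fun h => ⟨⟨fun i j => (h.1 i j).1, fun i j => (h.2 i j).1⟩,
    ⟨fun i j => (h.1 i j).2, fun i j => (h.2 i j).2⟩⟩,
    fun h => ⟨fun i j => ⟨h.1.1 i j, h.2.1 i j⟩, fun i j => ⟨h.1.2 i j, h.2.2 i j⟩⟩⟩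

theorem fstGL_rationalPoints (γ : GL (Fin 2) (RatFunc k)) :
    fstGL _ _ (rationalPoints k γ) =
      Matrix.GeneralLinearGroup.map (algebraMap (RatFunc k) (CompletionAtInfinity k)) γ := by
  ext i j
  rfl

theorem sndGL_rationalPoints (γ : GL (Fin 2) (RatFunc k)) :
    sndGL _ _ (rationalPoints k γ) = Matrix.GeneralLinearGroup.map
      (algebraMap (RatFunc k) (FiniteAdeleRing k[X] (RatFunc k))) γ := by
  ext i j
  rfl

/-- The adelic matrix which is `diag(Xⁿ, 1)` at infinity and trivial elsewhere. -/
noncomputable def diagAdele (n : ℕ) : GLAdele k := pairGL (diagInfinity n) 1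

/-- The adelic scalar matrix which is `z` at infinity and trivial elsewhere. -/
noncomputable def scalarAdele (z : (CompletionAtInfinity k)ˣ) : GLAdele k :=
  pairGL (upperTriangular z z 0) 1

theorem scalarAdele_mem (z : (CompletionAtInfinity k)ˣ) : scalarAdele z ∈ centerAdele k := by
  refine ⟨⟨(z.val, 1), (z⁻¹.val, 1), by simp, by simp⟩, ext_fstGL_sndGL ?_ ?_⟩
  · ext i j
    fin_cases i <;> fin_cases j <;>
      simp [scalarAdele, fstGL, pairGL, val_upperTriangular, Matrix.GeneralLinearGroup.scalar]
  · ext i j : 2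
    fin_cases i <;> fin_cases j <;>
      simp [scalarAdele, sndGL, pairGL, Matrix.GeneralLinearGroup.scalar]

theorem map_polynomial_mem_finiteIntegers (p : k[X]) :
    algebraMap (RatFunc k) (FiniteAdeleRing k[X] (RatFunc k)) (algebraMap k[X] (RatFunc k) p) ∈
      finiteIntegers k :=
  mem_finiteIntegers.mpr fun v => (valued_algebraMap v _).trans_le (valuation_le_one v p)

theorem map_polynomial_mem_integralGL (δ : GL (Fin 2) k[X]) :
    Matrix.GeneralLinearGroup.map (algebraMap (RatFunc k) (FiniteAdeleRing k[X] (RatFunc k)))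
      (Matrix.GeneralLinearGroup.map (algebraMap k[X] (RatFunc k)) δ) ∈
        integralGL (finiteIntegers k) :=
  ⟨fun i j => map_polynomial_mem_finiteIntegers _, fun i j => by
    rw [← map_inv, ← map_inv]
    exact map_polynomial_mem_finiteIntegers _⟩

/-- The matrix δ used for reduction at infinity is invertible over k[X], hence integral at all
finite places, so it does not spoil the finite decomposition. -/
theorem exists_adelic_decomposition (g : GLAdele k) :
    ∃ (γ : GL (Fin 2) (RatFunc k)) (n : ℕ), ∃ κ ∈ maximalCompact k,
      ∃ z : (CompletionAtInfinity k)ˣ,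
        g = rationalPoints k γ * diagAdele n * κ * scalarAdele z := by
  obtain ⟨γ, κ, hκ, hγ⟩ := exists_finite_decomposition (sndGL _ _ g)
  obtain ⟨δ, j, κ', hκ', z, hz⟩ := isReducible_infinity
    ((Matrix.GeneralLinearGroup.map (algebraMap _ _) γ)⁻¹ * fstGL _ _ g)
  set δ' := Matrix.GeneralLinearGroup.map (algebraMap k[X] (RatFunc k)) δ with hδ'
  refine ⟨γ * δ', j, pairGL κ' ((Matrix.GeneralLinearGroup.map (algebraMap _ _) δ')⁻¹ * κ),
    mem_maximalCompact_iff.mpr ⟨?_, ?_⟩, z, ext_fstGL_sndGL ?_ ?_⟩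
  · rwa [fstGL_pairGL]
  · rw [sndGL_pairGL]
    exact mul_mem (inv_mem (map_polynomial_mem_integralGL δ)) hκ
  · rw [inv_mul_eq_iff_eq_mul] at hz
    rw [hz]
    simp only [map_mul, fstGL_rationalPoints, diagAdele, scalarAdele, fstGL_pairGL, mul_assoc]
    rfl
  · simp only [map_mul, sndGL_rationalPoints, diagAdele, scalarAdele, sndGL_pairGL, mul_one]
    rw [mul_assoc, mul_inv_cancel_left, hγ]

theorem exists_polynomialGL_of_mem {γ : GL (Fin 2) (RatFunc k)}
    (hγ : Matrix.GeneralLinearGroup.map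
      (algebraMap (RatFunc k) (FiniteAdeleRing k[X] (RatFunc k))) γ ∈
        integralGL (finiteIntegers k)) :
    ∃ δ, Matrix.GeneralLinearGroup.map (algebraMap k[X] (RatFunc k)) δ = γ := by
  have key : ∀ y : RatFunc k, algebraMap (RatFunc k) (FiniteAdeleRing k[X] (RatFunc k)) y ∈
      finiteIntegers k → ∃ p, algebraMap k[X] (RatFunc k) p = y := fun y hy =>
    exists_polynomial_of_forall_valuation_le_one fun v =>
      (valued_algebraMap v y).symm.trans_le (mem_finiteIntegers.mp hy v)
  choose p hp using fun i j => key _ (hγ.1 i j)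
  have hγ2 := hγ.2
  rw [← map_inv] at hγ2
  choose q hq using fun i j => key _ (hγ2 i j)
  have hinj : Function.Injective ((algebraMap k[X] (RatFunc k)).mapMatrix (m := Fin 2)) :=
    Matrix.map_injective (RatFunc.algebraMap_injective k)
  have ha : (algebraMap k[X] (RatFunc k)).mapMatrix (Matrix.of p) = γ.val := by
    ext i j
    exact hp i j
  have hb : (algebraMap k[X] (RatFunc k)).mapMatrix (Matrix.of q) = γ⁻¹.val := by
    ext i j
    exact hq i j
  refine ⟨⟨Matrix.of p, Matrix.of q, hinj ?_, hinj ?_⟩, Units.ext ha⟩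
  · rw [map_mul, ha, hb, map_one, Units.mul_inv]
  · rw [map_mul, ha, hb, map_one, Units.inv_mul]

theorem valued_det_of_mem {κ : GL (Fin 2) (CompletionAtInfinity k)}
    (hκ : κ ∈ integralGL (infinityIntegers k)) : Valued.v κ.val.det = 1 := by
  have key : ∀ g ∈ integralGL (infinityIntegers k), Valued.v g.val.det ≤ 1 := fun g hg => by
    rw [Matrix.det_fin_two]
    exact sub_mem (H := infinityIntegers k) (mul_mem (hg.1 _ _) (hg.1 _ _))
      (mul_mem (hg.1 _ _) (hg.1 _ _))
  have h1 := congrArg Valued.v (congrArg Matrix.det κ.mul_inv)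
  rw [Matrix.det_mul, map_mul, Matrix.det_one, map_one] at h1
  refine le_antisymm (key κ hκ) (h1.symm.trans_le ?_)
  exact mul_le_of_le_one_right' (key _ (inv_mem hκ))

theorem valued_det_polynomial (δ : GL (Fin 2) k[X]) :
    Valued.v (Matrix.GeneralLinearGroup.map polyInfinity δ).val.det = 1 := by
  obtain ⟨c, hc, h⟩ := Polynomial.isUnit_iff.mp
    ((Matrix.isUnit_iff_isUnit_det δ.val).mp δ.isUnit)
  have h1 : (Matrix.GeneralLinearGroup.map polyInfinity δ).val.det = polyInfinity δ.val.det :=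
    (RingHom.map_det _ _).symm
  rw [h1, ← h, valued_polyInfinity (C_ne_zero.mpr hc.ne_zero), natDegree_C]
  simp

theorem val_diagInfinity (n : ℤ) :
    (diagInfinity n : GL (Fin 2) (CompletionAtInfinity k)).val = !![(unitX k ^ n).val, 0; 0, 1] :=
  rfl

theorem valued_mul_diag_mul_le {κ κ' : GL (Fin 2) (CompletionAtInfinity k)}
    (hκ : κ ∈ integralGL (infinityIntegers k)) (hκ' : κ' ∈ integralGL (infinityIntegers k))
    (n : ℕ) (i j : Fin 2) :
    Valued.v ((κ * diagInfinity n * κ').val i j) ≤ WithZero.exp (n : ℤ) := by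
  have hn : (1 : WithZero (Multiplicative ℤ)) ≤ WithZero.exp (n : ℤ) :=
    WithZero.exp_zero.symm.trans_le (WithZero.exp_le_exp.mpr (Nat.cast_nonneg n))
  have h : (κ * diagInfinity n * κ').val i j =
      κ.val i 0 * (unitX k ^ (n : ℤ)).val * κ'.val 0 j + κ.val i 1 * κ'.val 1 j := by
    rw [Units.val_mul, Units.val_mul, val_diagInfinity]
    simp [Matrix.mul_apply]
  rw [h]
  refine Valued.v.map_add_le ?_ ?_
  · rw [map_mul, map_mul, valued_unitX_zpow]
    calc _ ≤ 1 * WithZero.exp (n : ℤ) * 1 := by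
          gcongr
          exacts [hκ.1 _ _, hκ'.1 _ _]
      _ = _ := by simp
  · exact (mul_mem (hκ.1 i 1) (hκ'.1 1 j) : _ ∈ infinityIntegers k).trans hn

/-- The finite places put γ in GL₂(k[X]). At infinity, determinants give n = j + 2s with |z| = exp
s. If j > n, then j + s > n, whereas the entries of κd_nκ'⁻¹ are at most exp n; so the first column
of γ consists of polynomials smaller than 1, that is, of zeros. -/
theorem diagAdele_bound {κ κ' : GLAdele k} (hκ : κ ∈ maximalCompact k)
    (hκ' : κ' ∈ maximalCompact k) {n j : ℕ} {γ : GL (Fin 2) (RatFunc k)}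
    {z : (CompletionAtInfinity k)ˣ}
    (h : κ * diagAdele n = rationalPoints k γ * diagAdele j * κ' * scalarAdele z) : j ≤ n := by
  rw [mem_maximalCompact_iff] at hκ hκ'
  have h2 := congrArg (sndGL _ _) h
  simp only [map_mul, sndGL_rationalPoints, diagAdele, scalarAdele, sndGL_pairGL, mul_one] at h2
  obtain ⟨δ, rfl⟩ := exists_polynomialGL_of_mem (γ := γ) (by
    rw [← mul_inv_eq_iff_eq_mul] at h2
    rw [← h2]
    exact mul_mem hκ.2 (inv_mem hκ'.2))
  have h1 := congrArg (fstGL _ _) h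
  simp only [map_mul, fstGL_rationalPoints, diagAdele, scalarAdele, fstGL_pairGL] at h1
  change _ = Matrix.GeneralLinearGroup.map polyInfinity δ * _ * _ * _ at h1
  have hdet := congrArg (fun g => Valued.v g.val.det) h1
  simp only [Units.val_mul, Matrix.det_mul, map_mul, valued_det_polynomial,
    valued_det_of_mem hκ.1, valued_det_of_mem hκ'.1, one_mul, mul_one, val_diagInfinity,
    Matrix.det_fin_two_of, zero_mul, sub_zero, valued_unitX_zpow, val_upperTriangular] at hdet
  obtain ⟨s, hs⟩ : ∃ s : ℤ, Valued.v z.val = WithZero.exp s :=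
    ⟨_, (WithZero.exp_log ((Valuation.ne_zero_iff _).mpr z.ne_zero)).symm⟩
  rw [hs, ← WithZero.exp_add, ← WithZero.exp_add, WithZero.exp_inj] at hdet
  by_contra! hlt
  have h3 : Matrix.GeneralLinearGroup.map polyInfinity δ * diagInfinity j *
      upperTriangular z z 0 = fstGL _ _ κ * diagInfinity n * (fstGL _ _ κ')⁻¹ := by
    rw [h1, mul_assoc _ (fstGL _ _ κ'), ← upperTriangular_scalar_comm z (fstGL _ _ κ')]
    simp only [mul_assoc, mul_inv_cancel, mul_one]
  have hcol : ∀ i, δ.val i 0 = 0 := fun i => by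
    have h4 := valued_mul_diag_mul_le hκ.1 (inv_mem hκ'.1) n i 0
    have h5 : (Matrix.GeneralLinearGroup.map polyInfinity δ * diagInfinity j *
        upperTriangular z z 0).val i 0 =
          polyInfinity (δ.val i 0) * (unitX k ^ (j : ℤ)).val * z.val := by
      rw [Units.val_mul, Units.val_mul, val_diagInfinity, val_upperTriangular]
      simp [Matrix.mul_apply]
    rw [← h3, h5, map_mul, map_mul, valued_unitX_zpow, hs, mul_assoc, ← WithZero.exp_add] at h4
    apply polynomial_eq_zero_of_valued_lt_one
    have h6 : WithZero.exp (n : ℤ) < WithZero.exp ((j : ℤ) + s) :=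
      WithZero.exp_lt_exp.mpr (by lia)
    by_contra! h7
    refine (h4.trans_lt h6).not_ge ?_
    exact le_mul_of_one_le_left' h7
  have hunit := (Matrix.isUnit_iff_isUnit_det δ.val).mp δ.isUnit
  rw [Matrix.det_fin_two, hcol, hcol] at hunit
  simp at hunit

end Adelic

/-! ### Centralizers and constant quadratic polynomials -/

section Commutant

variable {R : Type*} [CommRing R]

/-- The conjugating matrix has columns e₀ and We₀, a cyclic basis when the corner of W is
invertible. -/
theorem mul_companion {W : Matrix (Fin 2) (Fin 2) R} {t n : R}
    (hW : W * W = t • W - n • (1 : Matrix (Fin 2) (Fin 2) R)) :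
    W * !![1, W 0 0; 0, W 1 0] = !![1, W 0 0; 0, W 1 0] * !![0, -n; 1, t] := by
  have h0 := congrFun₂ hW 0 0
  have h1 := congrFun₂ hW 1 0
  simp [Matrix.mul_apply] at h0 h1
  ext i j
  fin_cases i <;> fin_cases j <;> simp [Matrix.mul_apply]
  · linear_combination h0
  · linear_combination h1

/-- An invertible corner makes e₀ a cyclic vector, so a matrix commuting with W is determined by its
first column. -/
theorem eq_add_smul_of_commute {W M : Matrix (Fin 2) (Fin 2) R} {r : R} (hr : r * W 1 0 = 1)
    (h : M * W = W * M) :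
    M = (M 0 0 - r * M 1 0 * W 0 0) • (1 : Matrix (Fin 2) (Fin 2) R) + (r * M 1 0) • W := by
  have h0 := congrFun₂ h 0 0
  have h1 := congrFun₂ h 1 0
  simp only [Matrix.mul_apply, Fin.sum_univ_two] at h0 h1
  ext i j
  fin_cases i <;> fin_cases j <;> simp
  · linear_combination r * h0 - M 0 1 * hr
  · linear_combination (-M 1 0) * hr
  · linear_combination r * h1 - (M 1 1 - M 0 0) * hr

end Commutant

section Constants

open IsDedekindDomain HeightOneSpectrum

variable {k : Type u} [Field k]

theorem algebraMap_C_mem_integralAdeles (c : k) :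
    algebraMap (RatFunc k) (Adele k) (RatFunc.C c) ∈ integralAdeles k := by
  rw [← RatFunc.algebraMap_C]
  exact ⟨valued_polyInfinity_C_le_one c, map_polynomial_mem_finiteIntegers (C c)⟩

theorem exists_eq_C_of_mem_integralAdeles {y : RatFunc k}
    (hy : algebraMap (RatFunc k) (Adele k) y ∈ integralAdeles k) : ∃ c, y = RatFunc.C c := by
  obtain ⟨p, rfl⟩ := exists_polynomial_of_forall_valuation_le_one fun v =>
    (valued_algebraMap v y).symm.trans_le (hy.2 v)
  obtain ⟨c, rfl⟩ := polynomial_eq_C_of_valued_le_one hy.1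
  exact ⟨c, RatFunc.algebraMap_C c⟩

/-- A root is integral over k[X], hence a polynomial, and comparing degrees makes it constant. -/
theorem no_root_ratFunc {τ ν : k} (h : ∀ c : k, c * c ≠ τ * c - ν) (y : RatFunc k) :
    y * y ≠ RatFunc.C τ * y - RatFunc.C ν := by
  intro hy
  have hint : IsIntegral k[X] y := by
    refine ⟨X ^ 2 - C (C τ) * X + C (C ν), ?_, ?_⟩
    · monicity!
    · simp [RatFunc.algebraMap_C]
      linear_combination hy
  obtain ⟨p, rfl⟩ := IsIntegrallyClosed.algebraMap_eq_of_integral hint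
  rw [← RatFunc.algebraMap_C, ← RatFunc.algebraMap_C, ← map_mul, ← map_mul, ← map_sub] at hy
  have hp := RatFunc.algebraMap_injective k hy
  have hdeg : p.natDegree = 0 := by
    have h1 : (p * p).natDegree ≤ p.natDegree := by
      rw [hp]
      refine (natDegree_sub_le _ _).trans (max_le (natDegree_C_mul_le _ _) ?_)
      simp
    rcases eq_or_ne p 0 with rfl | h0
    · simp
    · rw [natDegree_mul h0 h0] at h1
      lia
  rw [eq_C_of_natDegree_eq_zero hdeg, ← C_mul, ← C_mul, ← C_sub] at hp
  exact h _ (C_injective hp)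

end Constants

/-! ### The torus as the centralizer of W -/

section Torus

variable {k : Type u} [Field k] {E : Type v} [Field E] [Algebra (RatFunc k) E]
  (b : Module.Basis (Fin 2) (RatFunc k) E)

theorem leftMulMatrix_baseChange_tmul (x : Adele k) (e : E) :
    Algebra.leftMulMatrix (b.baseChange (Adele k)) (x ⊗ₜ[RatFunc k] e) =
      x • (Algebra.leftMulMatrix b e).map (algebraMap (RatFunc k) (Adele k)) := by
  refine Matrix.ext fun i j => ?_
  simp [Algebra.leftMulMatrix_eq_repr_mul,
    Algebra.TensorProduct.tmul_mul_tmul, Module.Basis.baseChange_apply,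
    Module.Basis.baseChange_repr_tmul, Algebra.smul_def, mul_comm]

variable {b} {ω : E} {τ ν : k}

theorem leftMulMatrix_mul_self
    (hω : ω * ω = RatFunc.C τ • ω - RatFunc.C ν • (1 : E)) :
    Algebra.leftMulMatrix b ω * Algebra.leftMulMatrix b ω =
      RatFunc.C τ • Algebra.leftMulMatrix b ω - RatFunc.C ν • 1 := by
  rw [← map_mul, hω, map_sub, map_smul, map_smul, map_one]

/-- With a zero corner, the diagonal entry `W 0 0` would be an eigenvalue in F. -/
theorem corner_ne_zero {W : Matrix (Fin 2) (Fin 2) (RatFunc k)}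
    (hW : W * W = RatFunc.C τ • W - RatFunc.C ν • 1) (h : ∀ c : k, c * c ≠ τ * c - ν) :
    W 1 0 ≠ 0 := by
  intro h0
  have h1 := congrFun₂ hW 0 0
  simp [Matrix.mul_apply, h0] at h1
  exact no_root_ratFunc h _ h1

variable (hω : ω * ω = RatFunc.C τ • ω - RatFunc.C ν • (1 : E))
  (h : ∀ c : k, c * c ≠ τ * c - ν)

include hω h in
theorem exists_leftMulMatrix_eq {M : Matrix (Fin 2) (Fin 2) (Adele k)}
    (hM : M * (Algebra.leftMulMatrix b ω).map (algebraMap (RatFunc k) (Adele k)) =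
      (Algebra.leftMulMatrix b ω).map (algebraMap (RatFunc k) (Adele k)) * M) :
    ∃ x, Algebra.leftMulMatrix (b.baseChange (Adele k)) x = M := by
  have h0 := corner_ne_zero (leftMulMatrix_mul_self (b := b) hω) h
  have hr : algebraMap (RatFunc k) (Adele k) (Algebra.leftMulMatrix b ω 1 0)⁻¹ *
      (Algebra.leftMulMatrix b ω).map (algebraMap (RatFunc k) (Adele k)) 1 0 = 1 := by
    rw [Matrix.map_apply, ← map_mul, inv_mul_cancel₀ h0, map_one]
  obtain ⟨x, y, rfl⟩ : ∃ x y : Adele k, M = x • (1 : Matrix (Fin 2) (Fin 2) (Adele k)) +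
      y • (Algebra.leftMulMatrix b ω).map (algebraMap (RatFunc k) (Adele k)) :=
    ⟨_, _, eq_add_smul_of_commute hr hM⟩
  refine ⟨x ⊗ₜ 1 + y ⊗ₜ ω, ?_⟩
  rw [map_add, leftMulMatrix_baseChange_tmul, leftMulMatrix_baseChange_tmul, map_one,
    Matrix.map_one _ (map_zero _) (map_one _)]

include hω h in
-- The centralizer of W is the algebra generated by W; the inverse of g commutes with W too, so g
-- comes from a unit of 𝐀 ⊗ E.
theorem mem_torusAdele_iff {g : GLAdele k} : g ∈ torusAdele b ↔
    g.val * (Algebra.leftMulMatrix b ω).map (algebraMap (RatFunc k) (Adele k)) =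
      (Algebra.leftMulMatrix b ω).map (algebraMap (RatFunc k) (Adele k)) * g.val := by
  constructor
  · rintro ⟨x, rfl⟩
    have h1 := leftMulMatrix_baseChange_tmul b 1 ω
    rw [one_smul] at h1
    rw [← h1]
    change Algebra.leftMulMatrix _ x.val * _ = _ * Algebra.leftMulMatrix _ x.val
    rw [← map_mul, ← map_mul, mul_comm]
  · intro hg
    obtain ⟨x, hx⟩ := exists_leftMulMatrix_eq hω h hg
    obtain ⟨y, hy⟩ := exists_leftMulMatrix_eq (b := b) (M := g⁻¹.val) hω h (by
      rw [Units.inv_mul_eq_iff_eq_mul, ← mul_assoc, hg, mul_assoc, Units.mul_inv, mul_one])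
    have hinj := Algebra.leftMulMatrix_injective (b.baseChange (Adele k))
    refine ⟨⟨x, y, hinj ?_, hinj ?_⟩, Units.ext hx⟩
    · rw [map_mul, hx, hy, map_one, Units.mul_inv]
    · rw [map_mul, hx, hy, map_one, Units.inv_mul]

include hω h in
theorem rationalPoints_mem_torusRational {e : GL (Fin 2) (RatFunc k)}
    (he : e.val * Algebra.leftMulMatrix b ω = Algebra.leftMulMatrix b ω * e.val) :
    rationalPoints k e ∈ torusRational b := by
  have h0 := corner_ne_zero (leftMulMatrix_mul_self (b := b) hω) h
  have h1 := eq_add_smul_of_commute (inv_mul_cancel₀ h0) he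
  set y := (Algebra.leftMulMatrix b ω 1 0)⁻¹ * e.val 1 0
  set x := e.val 0 0 - y * Algebra.leftMulMatrix b ω 0 0
  have h2 : Algebra.leftMulMatrix b (x • (1 : E) + y • ω) = e.val := by
    rw [map_add, map_smul, map_smul, map_one, ← h1]
  have hne : x • (1 : E) + y • ω ≠ 0 := by
    intro h3
    rw [h3, map_zero] at h2
    exact e.ne_zero h2.symm
  refine ⟨Units.mk0 _ hne, Units.ext ?_⟩
  change Algebra.leftMulMatrix (b.baseChange (Adele k)) (1 ⊗ₜ (x • (1 : E) + y • ω)) = _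
  rw [leftMulMatrix_baseChange_tmul, h2, one_smul]
  rfl

end Torus

/-! ### Decomposition of the adelic torus -/

section Monoid

variable {M : Type*} [Monoid M] {g γ : Mˣ} {w w₀ : M}

/-- Both g and tg carry w to w₀, and the central factor z drops out. -/
theorem conj_mul_eq_of_commute {t m z : Mˣ} (ht : t * w = w * t) (hg : w * g = g * w₀)
    (hz : t * g = γ * m * z) (hc : ∀ x : M, z * x = x * z) :
    (γ⁻¹ : Mˣ) * w * γ * m = m * w₀ := by
  have h1 : w * (t * g : Mˣ) = (t * g : Mˣ) * w₀ := by
    rw [Units.val_mul, ← mul_assoc, ← ht, mul_assoc, hg, mul_assoc]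
  rw [hz, Units.val_mul, mul_assoc _ _ w₀, hc, ← mul_assoc, ← mul_assoc] at h1
  have h2 := z.isUnit.mul_left_inj.mp h1
  rw [mul_assoc, mul_assoc, Units.inv_mul_eq_iff_eq_mul]
  simpa only [Units.val_mul, mul_assoc] using h2

/-- Two elements, γp and g, carrying w to the same w₀ differ by an element of the centralizer of w.
-/
theorem commute_of_conj_mul_eq {p : Mˣ} (hg : w * g = g * w₀)
    (hp : (γ⁻¹ : Mˣ) * w * γ * p = p * w₀) :
    (γ * p * g⁻¹ : Mˣ) * w = w * (γ * p * g⁻¹ : Mˣ) := by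
  have h1 : (g⁻¹ : Mˣ) * w = w₀ * (g⁻¹ : Mˣ) := by
    rw [Units.inv_mul_eq_iff_eq_mul, ← mul_assoc, ← hg, mul_assoc, Units.mul_inv, mul_one]
  rw [mul_assoc, mul_assoc, Units.inv_mul_eq_iff_eq_mul] at hp
  rw [Units.val_mul, Units.val_mul, mul_assoc _ _ w, h1, ← mul_assoc, ← mul_assoc,
    mul_assoc _ _ w₀, ← hp]

end Monoid

theorem eq_mul_conj_mul {G : Type*} [Group G] {t g γ κ z : G} (p : G)
    (hz : t * g = γ * κ * z) (hc : ∀ x, z * x = x * z) :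
    t = γ * p * g⁻¹ * (g * (p⁻¹ * κ) * g⁻¹) * z := by
  rw [← eq_mul_inv_iff_mul_eq] at hz
  rw [hz, mul_assoc _ z, hc]
  group

section TorusDecomposition

open IsDedekindDomain HeightOneSpectrum

variable {k : Type u} [Field k]

theorem scalarAdele_comm (z : (CompletionAtInfinity k)ˣ) (g : GLAdele k) :
    scalarAdele z * g = g * scalarAdele z := by
  refine ext_fstGL_sndGL ?_ ?_
  · simp only [map_mul, scalarAdele, fstGL_pairGL, upperTriangular_scalar_comm]
  · simp only [map_mul, scalarAdele, sndGL_pairGL, one_mul, mul_one]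

theorem scalarAdele_comm_matrix (z : (CompletionAtInfinity k)ˣ)
    (M : Matrix (Fin 2) (Fin 2) (Adele k)) :
    (scalarAdele z).val * M = M * (scalarAdele z).val := by
  obtain ⟨c, hc⟩ := scalarAdele_mem z
  rw [← hc]
  exact Matrix.scalar_commute (c : Adele k) (fun r => mul_comm _ r) M

theorem diagAdele_zero : (diagAdele 0 : GLAdele k) = 1 := by
  refine ext_fstGL_sndGL ?_ ?_
  · rw [diagAdele, fstGL_pairGL, map_one]
    ext i j
    fin_cases i <;> fin_cases j <;> simp [val_diagInfinity]
  · rw [diagAdele, sndGL_pairGL, map_one]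

theorem val_diagAdele (n : ℕ) : (diagAdele n : GLAdele k).val =
    !![((unitX k ^ (n : ℤ)).val, 1), 0; 0, 1] := by
  refine Matrix.ext fun i j => ?_
  fin_cases i <;> fin_cases j <;> rfl

/-- If a rational matrix with nonzero lower left corner becomes integral after conjugation by
`diag(Xⁿ, 1)` at infinity, then `n = 0` and the matrix is constant. -/
theorem eq_zero_of_conj_integral {A : Matrix (Fin 2) (Fin 2) (RatFunc k)} (hA : A 1 0 ≠ 0)
    {B : Matrix (Fin 2) (Fin 2) (Adele k)} (hB : ∀ i j, B i j ∈ integralAdeles k) {n : ℕ}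
    (h : A.map (algebraMap (RatFunc k) (Adele k)) * (diagAdele n).val = (diagAdele n).val * B) :
    n = 0 ∧ ∀ i j, ∃ c, A i j = RatFunc.C c := by
  -- For n > 0 the lower left entry would be a polynomial p with |p| exp n ≤ 1, hence zero.
  have hn : n = 0 := by
    by_contra hn
    have h10 := congrFun₂ h 1 0
    simp only [Matrix.mul_apply, Fin.sum_univ_two, val_diagAdele, Matrix.map_apply] at h10
    have h1 : (algebraMap (RatFunc k) (Adele k) (A 1 0)) * ((unitX k ^ (n : ℤ)).val, 1) = B 1 0 := by
      simpa using h10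
    have h2 := hB 1 0
    rw [← h1] at h2
    obtain ⟨h3, h4⟩ := h2
    obtain ⟨p, hp⟩ := exists_polynomial_of_forall_valuation_le_one fun v =>
      (valued_algebraMap v (A 1 0)).symm.trans_le (by
        have h5 := h4 v
        rw [Prod.snd_mul, mul_one] at h5
        exact h5)
    rw [Prod.fst_mul, Valuation.mem_integer_iff, map_mul, valued_unitX_zpow, ← hp] at h3
    have hp0 : p = 0 := by
      apply polynomial_eq_zero_of_valued_lt_one
      by_contra! h7
      have h6 : (1 : WithZero (Multiplicative ℤ)) < WithZero.exp (n : ℤ) := by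
        rw [← WithZero.exp_zero, WithZero.exp_lt_exp]
        lia
      exact (h3.trans_lt h6).not_ge (le_mul_of_one_le_left' h7)
    rw [hp0, map_zero] at hp
    exact hA hp.symm
  subst hn
  rw [diagAdele_zero, Units.val_one, mul_one, one_mul] at h
  exact ⟨rfl, fun i j => exists_eq_C_of_mem_integralAdeles (by
    have h1 := hB i j
    rwa [← h] at h1)⟩

variable {W : Matrix (Fin 2) (Fin 2) (RatFunc k)} {τ ν : k}

theorem exists_torus_decomposition (hW : W * W = RatFunc.C τ • W - RatFunc.C ν • 1)
    (h : ∀ c : k, c * c ≠ τ * c - ν) {g₀ : GL (Fin 2) (RatFunc k)}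
    (hg₀ : W * g₀.val = g₀.val * !![0, -RatFunc.C ν; 1, RatFunc.C τ])
    {t : GLAdele k} (ht : t.val * W.map (algebraMap (RatFunc k) (Adele k)) =
      W.map (algebraMap (RatFunc k) (Adele k)) * t.val) :
    ∃ e : GL (Fin 2) (RatFunc k), e.val * W = W * e.val ∧ ∃ κ ∈ maximalCompact k,
      ∃ z : (CompletionAtInfinity k)ˣ, t = rationalPoints k e *
        (rationalPoints k g₀ * κ * (rationalPoints k g₀)⁻¹) * scalarAdele z := by
  obtain ⟨γ, n, κ, hκ, z, hz⟩ := exists_adelic_decomposition (t * rationalPoints k g₀)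
  set A := γ⁻¹.val * W * γ.val with hA
  have hAA : A * A = RatFunc.C τ • A - RatFunc.C ν • 1 := by
    have : A * A = γ⁻¹.val * (W * W) * γ.val := by
      rw [hA]
      simp only [mul_assoc, Units.mul_inv_cancel_left]
    rw [this, hW]
    simp only [mul_sub, sub_mul, hA, mul_smul_comm, smul_mul_assoc, mul_one, Units.inv_mul]
  have hA0 := corner_ne_zero hAA h
  let f := algebraMap (RatFunc k) (Adele k)
  have hf0 : ∀ M N : Matrix (Fin 2) (Fin 2) (RatFunc k), (M * N).map f = M.map f * N.map f :=
    fun M N => Matrix.map_mul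
  let W₀ : Matrix (Fin 2) (Fin 2) (RatFunc k) := !![0, -RatFunc.C ν; 1, RatFunc.C τ]
  have hconj : A.map f * (diagAdele n * κ).val = (diagAdele n * κ).val * W₀.map f := by
    have h1 : W.map f * (rationalPoints k g₀).val = (rationalPoints k g₀).val * W₀.map f := by
      have := congrArg (fun M => M.map f) hg₀
      rwa [hf0, hf0] at this
    have h2 := conj_mul_eq_of_commute (z := scalarAdele z) (m := diagAdele n * κ)
      (γ := rationalPoints k γ) ht h1 (hz.trans (by rw [mul_assoc (rationalPoints k γ)]))
      (scalarAdele_comm_matrix z)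
    rw [hA, hf0, hf0]
    rwa [← map_inv] at h2
  have hW₀ : ∀ i j, W₀.map f i j ∈ integralAdeles k := fun i j => by
    have h0 := algebraMap_C_mem_integralAdeles (0 : k)
    have h1 := algebraMap_C_mem_integralAdeles (1 : k)
    have h2 := algebraMap_C_mem_integralAdeles (-ν)
    have h3 := algebraMap_C_mem_integralAdeles τ
    rw [map_zero] at h0
    rw [map_one] at h1
    rw [map_neg] at h2
    fin_cases i <;> fin_cases j <;> assumption
  rw [maximalCompact_eq] at hκ
  obtain ⟨hn, hC⟩ := eq_zero_of_conj_integral (A := A) (B := κ.val * W₀.map f * κ⁻¹.val) (n := n)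
    hA0 (fun i j => by
      simp only [Matrix.mul_apply]
      exact sum_mem fun l _ => mul_mem (sum_mem fun l _ => mul_mem (hκ.1 _ _) (hW₀ _ _)) (hκ.2 _ _))
    (by
      rw [← mul_assoc, ← mul_assoc, ← Units.val_mul, ← hconj, Units.val_mul, mul_assoc,
        mul_assoc, Units.mul_inv, mul_one])
  rw [hn, diagAdele_zero, mul_one] at hz
  obtain ⟨c, hc⟩ := hC 1 0
  obtain ⟨d, hd⟩ := hC 0 0
  -- The columns of P are e₀ and Ae₀, with A constant; so P lies in K and passes from κ to the
  -- rational factor, which then commutes with W.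
  set P := upperTriangular 1 (Units.mk0 _ hA0) (A 0 0)
  have hPW : A * P.val = P.val * W₀ := mul_companion hAA
  have hP : rationalPoints k P ∈ integralGL (integralAdeles k) := by
    rw [rationalPoints, map_upperTriangular]
    refine upperTriangular_mem (one_mem _) (one_mem _) ?_ ?_ ?_
    · change algebraMap (RatFunc k) (Adele k) (A 1 0) ∈ _
      rw [hc]
      exact algebraMap_C_mem_integralAdeles c
    · change algebraMap (RatFunc k) (Adele k) (A 1 0)⁻¹ ∈ _
      rw [hc, ← map_inv₀]
      exact algebraMap_C_mem_integralAdeles _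
    · rw [hd]
      exact algebraMap_C_mem_integralAdeles d
  refine ⟨γ * P * g₀⁻¹, ?_, (rationalPoints k P)⁻¹ * κ, ?_, z, ?_⟩
  · exact commute_of_conj_mul_eq hg₀ hPW
  · rw [maximalCompact_eq]
    exact mul_mem (inv_mem hP) hκ
  · rw [map_mul, map_mul, map_inv]
    exact eq_mul_conj_mul _ hz (scalarAdele_comm z)

end TorusDecomposition

/-! ### Topology of K and values of unramified forms -/

section Topology

open IsDedekindDomain HeightOneSpectrum

variable {k : Type u} [Field k]

theorem isOpen_adicCompletionIntegers (v : HeightOneSpectrum k[X]) :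
    IsOpen (v.adicCompletionIntegers (RatFunc k) : Set (v.adicCompletion (RatFunc k))) :=
  Valued.isOpen_valuationSubring _

theorem isOpen_finiteIntegers :
    IsOpen (finiteIntegers k : Set (FiniteAdeleRing k[X] (RatFunc k))) :=
  RestrictedProduct.isOpen_forall_mem isOpen_adicCompletionIntegers

theorem isCompact_finiteIntegers [Finite k] :
    IsCompact (finiteIntegers k : Set (FiniteAdeleRing k[X] (RatFunc k))) := by
  have : ∀ v : HeightOneSpectrum k[X], CompactSpace (v.adicCompletionIntegers (RatFunc k)) :=
    fun v => isCompact_iff_compactSpace.mp (isCompact_adicCompletionIntegers v)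
  have h := isCompact_range (RestrictedProduct.isEmbedding_structureMap
    (R := fun v : HeightOneSpectrum k[X] => v.adicCompletion (RatFunc k))
    (A := fun v => (v.adicCompletionIntegers (RatFunc k) : Set (v.adicCompletion (RatFunc k))))
    (𝓕 := Filter.cofinite)).continuous
  rw [RestrictedProduct.range_structureMap] at h
  exact h

instance : T2Space (FiniteAdeleRing k[X] (RatFunc k)) :=
  inferInstanceAs (T2Space (RestrictedProduct
    (fun v : HeightOneSpectrum k[X] => v.adicCompletion (RatFunc k))
    (fun v => v.adicCompletionIntegers (RatFunc k)) Filter.cofinite))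

theorem isOpen_integralAdeles : IsOpen (integralAdeles k : Set (Adele k)) :=
  (Valued.isOpen_integer (CompletionAtInfinity k)).prod isOpen_finiteIntegers

theorem isCompact_integralAdeles [Finite k] : IsCompact (integralAdeles k : Set (Adele k)) :=
  isCompact_integer_infinity.prod isCompact_finiteIntegers

theorem isOpen_integralGL {R : Type*} [CommRing R] [TopologicalSpace R]
    {S : Subring R} (hS : IsOpen (S : Set R)) : IsOpen (integralGL S : Set (GL (Fin 2) R)) := by
  have h1 : IsOpen {M : Matrix (Fin 2) (Fin 2) R | ∀ i j, M i j ∈ S} := by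
    simp only [Set.ofPred_forall]
    exact isOpen_iInter_of_finite fun i => isOpen_iInter_of_finite fun j =>
      hS.preimage (continuous_id.matrix_elem i j)
  exact (h1.preimage Units.continuous_val).inter (h1.preimage Units.continuous_coe_inv)

theorem isCompact_integralGL {R : Type*} [CommRing R] [TopologicalSpace R] [IsTopologicalRing R]
    [T2Space R] {S : Subring R} (hS : IsCompact (S : Set R)) :
    IsCompact (integralGL S : Set (GL (Fin 2) R)) := by
  have h1 : IsCompact {M : Matrix (Fin 2) (Fin 2) R | ∀ i j, M i j ∈ S} := by
    have := isCompact_univ_pi fun _ : Fin 2 => isCompact_univ_pi fun _ : Fin 2 => hS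
    have h2 : {M : Matrix (Fin 2) (Fin 2) R | ∀ i j, M i j ∈ S} =
        Set.univ.pi fun _ => Set.univ.pi fun _ => (S : Set R) :=
      Set.ext fun M => ⟨fun hM i _ j _ => hM i j, fun hM i j => hM i trivial j trivial⟩
    rw [h2]
    exact this
  have h2 := h1.prod (h1.image MulOpposite.continuous_op)
  convert (Units.isClosedEmbedding_embedProduct
    (α := Matrix (Fin 2) (Fin 2) R)).isCompact_preimage h2 using 1
  ext g
  constructor
  · exact fun hg => ⟨hg.1, _, hg.2, rfl⟩
  · rintro ⟨hg, M, hM, hMg⟩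
    refine ⟨hg, ?_⟩
    have : M = g⁻¹.val := MulOpposite.op_injective hMg
    exact this ▸ hM

theorem isOpen_maximalCompact : IsOpen (maximalCompact k : Set (GLAdele k)) := by
  rw [maximalCompact_eq]
  exact isOpen_integralGL isOpen_integralAdeles

theorem isCompact_maximalCompact [Finite k] : IsCompact (maximalCompact k : Set (GLAdele k)) := by
  rw [maximalCompact_eq]
  exact isCompact_integralGL isCompact_integralAdeles

/-- The form is constant on each coset gK, and K is open. -/
theorem isLocallyConstant_unramifiedForms (f : unramifiedForms k) : IsLocallyConstant f.1 := by
  refine (IsLocallyConstant.iff_exists_open _).mpr fun g =>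
    ⟨(fun x => g⁻¹ * x) ⁻¹' (maximalCompact k : Set (GLAdele k)),
      isOpen_maximalCompact.preimage (continuous_const.mul continuous_id), ?_, fun x hx => ?_⟩
  · change g⁻¹ * g ∈ maximalCompact k
    rw [inv_mul_cancel]
    exact one_mem _
  · have h := f.2.2.1 _ hx g
    rwa [mul_inv_cancel_left] at h

theorem unramifiedForms_apply (f : unramifiedForms k) (γ : GL (Fin 2) (RatFunc k)) (g : GLAdele k)
    {κ : GLAdele k} (hκ : κ ∈ maximalCompact k) (z : (CompletionAtInfinity k)ˣ) :
    f.1 (rationalPoints k γ * g * κ * scalarAdele z) = f.1 g := by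
  rw [f.2.2.2 _ (scalarAdele_mem z), f.2.2.1 _ hκ, f.2.1]

theorem unramifiedForms_diag_of_mem (f : unramifiedForms k) {κ : GLAdele k}
    (hκ : κ ∈ maximalCompact k) (n : ℕ) : ∃ j ≤ n, f.1 (κ * diagAdele n) = f.1 (diagAdele j) := by
  obtain ⟨γ, j, κ', hκ', z, h⟩ := exists_adelic_decomposition (κ * diagAdele n)
  exact ⟨j, diagAdele_bound hκ hκ' h, by rw [h, unramifiedForms_apply f γ _ hκ']⟩

theorem eq_zero_of_forall_diagAdele {f : unramifiedForms k} (hf : ∀ n, f.1 (diagAdele n) = 0) :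
    f = 0 := by
  refine Subtype.ext (funext fun g => ?_)
  obtain ⟨γ, n, κ, hκ, z, rfl⟩ := exists_adelic_decomposition g
  rw [unramifiedForms_apply f γ _ hκ, hf]
  rfl

end Topology

/-! ### Compactness of the torus quotient and vanishing of toroidal forms -/

section Quotient

variable {k : Type u} [Field k] {E : Type v} [Field E] [Algebra (RatFunc k) E]
  {b : Module.Basis (Fin 2) (RatFunc k) E} {ω : E} {τ ν : k}
  (hω : ω * ω = RatFunc.C τ • ω - RatFunc.C ν • (1 : E)) (h : ∀ c : k, c * c ≠ τ * c - ν)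

theorem zero_mem_toroidalFormsWith (b : Module.Basis (Fin 2) (RatFunc k) E) :
    0 ∈ toroidalFormsWith b := by
  rintro g μ -
  refine (integral_congr_ae (Filter.Eventually.of_forall fun q => ?_)).trans
    (integral_zero (TorusQuotient b) ℂ)
  obtain ⟨t, rfl⟩ := QuotientGroup.mk_surjective q
  rfl

include hω h

theorem exists_conjugator : ∃ g₀ : GL (Fin 2) (RatFunc k),
    Algebra.leftMulMatrix b ω * g₀.val = g₀.val * !![0, -RatFunc.C ν; 1, RatFunc.C τ] := by
  have hW := leftMulMatrix_mul_self (b := b) hω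
  exact ⟨upperTriangular 1 (Units.mk0 _ (corner_ne_zero hW h)) _, mul_companion hW⟩

theorem isClosed_torusAdele : IsClosed (torusAdele b : Set (GLAdele k)) := by
  have : (torusAdele b : Set (GLAdele k)) = {g |
      g.val * (Algebra.leftMulMatrix b ω).map (algebraMap (RatFunc k) (Adele k)) =
      (Algebra.leftMulMatrix b ω).map (algebraMap (RatFunc k) (Adele k)) * g.val} :=
    Set.ext fun g => mem_torusAdele_iff hω h
  rw [this]
  exact isClosed_eq (Units.continuous_val.mul continuous_const)
    (continuous_const.mul Units.continuous_val)

theorem exists_torusAdele_decomposition {g₀ : GL (Fin 2) (RatFunc k)}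
    (hg₀ : Algebra.leftMulMatrix b ω * g₀.val = g₀.val * !![0, -RatFunc.C ν; 1, RatFunc.C τ])
    {t : GLAdele k} (ht : t ∈ torusAdele b) :
    ∃ e : GL (Fin 2) (RatFunc k), rationalPoints k e ∈ torusRational b ∧ ∃ κ ∈ maximalCompact k,
      ∃ z : (CompletionAtInfinity k)ˣ, t = rationalPoints k e *
        (rationalPoints k g₀ * κ * (rationalPoints k g₀)⁻¹) * scalarAdele z := by
  obtain ⟨e, he, κ, hκ, z, hz⟩ := exists_torus_decomposition (leftMulMatrix_mul_self hω) h hg₀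
    ((mem_torusAdele_iff hω h).mp ht)
  exact ⟨e, rationalPoints_mem_torusRational hω h he, κ, hκ, z, hz⟩

omit hω h in
theorem torusRational_le_torusAdele : torusRational b ≤ torusAdele b := by
  rintro _ ⟨x, rfl⟩
  exact ⟨_, rfl⟩

theorem scalarAdele_mem_torusAdele (z : (CompletionAtInfinity k)ˣ) :
    scalarAdele z ∈ torusAdele b :=
  (mem_torusAdele_iff hω h).mpr (scalarAdele_comm_matrix z _)

/-- By the torus decomposition, the compact set T_𝐀 ∩ g₀Kg₀⁻¹ maps onto the quotient. -/
theorem compactSpace_torusQuotient [Finite k] : CompactSpace (TorusQuotient b) := by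
  obtain ⟨g₀, hg₀⟩ := exists_conjugator (b := b) hω h
  set G := rationalPoints k g₀
  have h1 : IsCompact ((fun x => G * x * G⁻¹) '' (maximalCompact k : Set (GLAdele k))) :=
    isCompact_maximalCompact.image ((continuous_const.mul continuous_id).mul continuous_const)
  have h2 := (isClosed_torusAdele (b := b) hω h).isClosedEmbedding_subtypeVal.isCompact_preimage h1
  have h3 := h2.image (QuotientGroup.continuous_mk
    (N := (torusRational b ⊔ centerAdele k).subgroupOf (torusAdele b)))
  refine ⟨h3.of_isClosed_subset isClosed_univ fun q _ => ?_⟩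
  obtain ⟨t, rfl⟩ := QuotientGroup.mk_surjective q
  obtain ⟨e, he, κ, hκ, z, hz⟩ := exists_torusAdele_decomposition hω h hg₀ t.2
  have hc : G * κ * G⁻¹ ∈ torusAdele b := by
    have : G * κ * G⁻¹ = (rationalPoints k e)⁻¹ * t * (scalarAdele z)⁻¹ := by
      rw [hz]
      simp only [G]
      group
    rw [this]
    exact mul_mem (mul_mem (inv_mem (torusRational_le_torusAdele he)) t.2)
      (inv_mem (scalarAdele_mem_torusAdele hω h z))
  refine ⟨⟨_, hc⟩, ⟨κ, hκ, rfl⟩, QuotientGroup.eq.mpr ?_⟩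
  rw [Subgroup.mem_subgroupOf]
  have h4 : (⟨_, hc⟩ : torusAdele b)⁻¹ * t = ⟨_, torusRational_le_torusAdele he⟩ *
      ⟨_, scalarAdele_mem_torusAdele hω h z⟩ := by
    rw [inv_mul_eq_iff_eq_mul, ← mul_assoc, mul_comm' (⟨_, hc⟩ : torusAdele b)]
    exact Subtype.ext hz
  rw [h4]
  exact mul_mem (Subgroup.mem_sup_left he) (Subgroup.mem_sup_right (scalarAdele_mem z))

theorem toroidalFormsWith_eq [Finite k] : toroidalFormsWith b = {0} := by
  have := compactSpace_torusQuotient (b := b) hω h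
  refine Set.Subset.antisymm (fun f hf => ?_) ?_
  · refine eq_zero_of_forall_diagAdele fun n => ?_
    induction n using Nat.strong_induction_on with
    | _ n ih =>
    obtain ⟨g₀, hg₀⟩ := exists_conjugator (b := b) hω h
    set G := rationalPoints k g₀ with hG
    -- The factor G cancels against the conjugation in the torus decomposition, leaving values
    -- f(κd_n) with κ in K.
    set g := G * diagAdele n
    have hval : ∀ q, torusFunction b f g q = 0 ∨ torusFunction b f g q = f.1 (diagAdele n) := by
      intro q
      obtain ⟨t, rfl⟩ := QuotientGroup.mk_surjective q
      change f.1 ((t : GLAdele k) * g) = 0 ∨ f.1 ((t : GLAdele k) * g) = _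
      obtain ⟨e, -, κ, hκ, z, hz⟩ := exists_torusAdele_decomposition hω h hg₀ t.2
      have h1 : (t : GLAdele k) * g = rationalPoints k e * (G * (κ * diagAdele n)) * scalarAdele z := by
        rw [hz, mul_assoc _ (scalarAdele z), scalarAdele_comm]
        simp only [g, hG]
        group
      rw [h1, f.2.2.2 _ (scalarAdele_mem z), f.2.1, f.2.1]
      obtain ⟨j, hj, hfj⟩ := unramifiedForms_diag_of_mem f hκ n
      rw [hfj]
      rcases hj.lt_or_eq with hj | rfl
      · exact Or.inl (ih j hj)
      · exact Or.inr rfl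
    by_contra hne
    set c := f.1 (diagAdele n)
    set S := {q | torusFunction b f g q = c}
    have hS : IsOpen S := by
      refine isOpen_coinduced.mpr ?_
      exact ((isLocallyConstant_unramifiedForms f).isOpen_fiber c).preimage
        (continuous_subtype_val.mul continuous_const)
    have h1S : S.Nonempty := ⟨QuotientGroup.mk 1, by
      change f.1 (((1 : torusAdele b) : GLAdele k) * (G * diagAdele n)) = c
      rw [Subgroup.coe_one, one_mul, f.2.1]⟩
    -- Off S the integrand vanishes by the induction hypothesis, so its integral is c times the
    -- volume of S.
    have hind : torusFunction b f g = S.indicator fun _ => c := by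
      funext q
      by_cases hq : q ∈ S
      · rw [Set.indicator_of_mem hq]
        exact hq
      · rw [Set.indicator_of_notMem hq]
        exact (hval q).resolve_right hq
    let μ : Measure (TorusQuotient b) := Measure.haar
    have hint := hf g μ inferInstance
    rw [hind, integral_indicator_const c hS.measurableSet, smul_eq_zero] at hint
    have hpos := hS.measure_pos μ h1S
    rcases hint with h0 | h0
    · exact (ENNReal.toReal_pos hpos.ne' (measure_lt_top μ S).ne).ne' h0
    · exact hne h0
  · exact Set.singleton_subset_iff.mpr (zero_mem_toroidalFormsWith b)

end Quotient

/-! ### Quadratic constant extensions -/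

section Existence

variable {k : Type u} [Field k]

/-- The map c ↦ c - c² takes 0 and 1 to the same value, so on a finite field it is not surjective.
Trace 1 works in every characteristic, including 2. -/
theorem exists_no_root [Finite k] : ∃ ν : k, ∀ c : k, c * c ≠ 1 * c - ν := by
  by_contra! hν
  have hsurj : Function.Surjective fun c : k => c - c * c := fun ν => by
    obtain ⟨c, hc⟩ := hν ν
    exact ⟨c, by linear_combination -hc⟩
  have h01 : (0 : k) = 1 := (Finite.injective_iff_surjective.mpr hsurj) (by simp)
  exact zero_ne_one h01

/-- Ensures that the intersection defining T_F is taken over at least one constant extension.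
Separability holds already over k, a perfect field. -/
theorem exists_separable_quadratic_extension [Finite k] :
    ∃ (E : Type u) (_ : Field E) (_ : Algebra (RatFunc k) E)
      (_ : Algebra.IsSeparable (RatFunc k) E) (_ : Module.Basis (Fin 2) (RatFunc k) E) (ω : E)
      (τ ν : k), ω * ω = RatFunc.C τ • ω - RatFunc.C ν • (1 : E) ∧ ∀ c : k, c * c ≠ τ * c - ν := by
  obtain ⟨ν, hν⟩ := exists_no_root (k := k)
  set p : k[X] := X ^ 2 - X + C ν with hp
  have hdeg : p.natDegree = 2 := by
    rw [hp]
    compute_degree!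
  have hirr : Irreducible p := irreducible_of_degree_le_three_of_not_isRoot
    (by simp [hdeg]) fun c hc => hν c (by
      simp [hp] at hc
      linear_combination hc)
  set P : (RatFunc k)[X] := p.map RatFunc.C with hP
  have hPdeg : P.natDegree = 2 := by rw [hP, natDegree_map, hdeg]
  have hPirr : Irreducible P := irreducible_of_degree_le_three_of_not_isRoot
    (by simp [hPdeg]) fun c hc => no_root_ratFunc hν c (by
      simp [hp, hP] at hc
      rw [map_one]
      linear_combination hc)
  have : Fact (Irreducible P) := ⟨hPirr⟩
  have hroot : aeval (AdjoinRoot.root P) P = 0 := by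
    rw [AdjoinRoot.aeval_eq, AdjoinRoot.mk_self]
  have hsep : IsSeparable (RatFunc k) (AdjoinRoot.root P) :=
    (PerfectField.separable_of_irreducible hirr).map.of_dvd (minpoly.dvd _ _ hroot)
  have htop : IntermediateField.adjoin (RatFunc k) {AdjoinRoot.root P} = ⊤ :=
    IntermediateField.adjoin_root_eq_top P
  have h1 := (IntermediateField.isSeparable_adjoin_simple_iff_isSeparable (RatFunc k) _).mpr hsep
  rw [htop] at h1
  have h2 : Algebra.IsSeparable (RatFunc k) (AdjoinRoot P) :=
    Algebra.IsSeparable.of_equiv_equiv (RingEquiv.refl _)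
      (IntermediateField.topEquiv (F := RatFunc k) (E := AdjoinRoot P)).toRingEquiv rfl
  refine ⟨AdjoinRoot P, inferInstance, inferInstance, h2,
    (AdjoinRoot.powerBasis hPirr.ne_zero).basis.reindex (finCongr hPdeg), AdjoinRoot.root P,
    1, ν, ?_, hν⟩
  simp [hP, hp, ← Algebra.algebraMap_eq_smul_one] at hroot ⊢
  linear_combination hroot

/-- An element of l outside k has an irreducible quadratic minimal polynomial over k, hence one
without root in k, as `toroidalFormsWith_eq` requires. -/
theorem toroidalFormsWith_eq_of_isQuadraticConstantExtension [Finite k] {E : Type v} [Field E]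
    [Algebra k E] [Algebra (RatFunc k) E] [IsScalarTower k (RatFunc k) E]
    (hE : IsQuadraticConstantExtension k E) (b : Module.Basis (Fin 2) (RatFunc k) E) :
    toroidalFormsWith b = {0} := by
  obtain ⟨l, hl, -⟩ := hE
  obtain ⟨ω, hωl, hω⟩ : ∃ ω ∈ l, ω ∉ (⊥ : IntermediateField k E) := by
    by_contra! hle
    have hbot : l = ⊥ := le_bot_iff.mp fun x hx => hle x hx
    rw [hbot, IntermediateField.finrank_bot] at hl
    simp at hl
  have : Module.Finite k l := Module.finite_of_finrank_pos (by lia)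
  set w : l := ⟨ω, hωl⟩
  have hint : IsIntegral k w := .of_finite k w
  have hdeg : (minpoly k w).natDegree = 2 := by
    refine le_antisymm ((minpoly.natDegree_le w).trans hl.le) ?_
    have h0 := minpoly.natDegree_pos hint
    have h1 : (minpoly k w).natDegree ≠ 1 := fun h1 => by
      obtain ⟨c, hc⟩ := minpoly.natDegree_eq_one_iff.mp h1
      exact hω (IntermediateField.mem_bot.mpr ⟨c, congrArg Subtype.val hc⟩)
    lia
  have hmonic := minpoly.monic hint
  have hirr := minpoly.irreducible hint
  have heq : minpoly k w = X ^ 2 + C ((minpoly k w).coeff 1) * X + C ((minpoly k w).coeff 0) := by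
    have h2 : (minpoly k w).coeff 2 = 1 := by
      rw [← hdeg]
      exact hmonic.coeff_natDegree
    conv_lhs => rw [(minpoly k w).as_sum_range_C_mul_X_pow, hdeg]
    simp [Finset.sum_range_succ, h2]
    ring
  set β := (minpoly k w).coeff 1
  set ν := (minpoly k w).coeff 0
  have haeval : w * w = -β • w - ν • 1 := by
    have := minpoly.aeval k w
    rw [heq] at this
    simp [Algebra.smul_def] at this ⊢
    linear_combination this
  refine toroidalFormsWith_eq (ω := ω) (τ := -β) (ν := ν) ?_ fun c hc => ?_
  · have h1 := congrArg (Subtype.val : l → E) haeval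
    rw [← RatFunc.algebraMap_eq_C, algebraMap_smul, algebraMap_smul]
    exact h1
  · have hr : (minpoly k w).IsRoot c := by
      rw [heq]
      simp
      linear_combination hc
    exact hirr.not_isRoot_of_natDegree_ne_one (by lia) hr

end Existence

end ToroidalForms

theorem theoremP1 (k : Type u) [Field k] [Finite k] :
    ToroidalForms.toroidalForms k = {0} ∧
    ∀ (E : Type v) [Field E] [Algebra k E] [Algebra (RatFunc k) E]
      [IsScalarTower k (RatFunc k) E], ToroidalForms.IsQuadraticConstantExtension k E →
      ∀ b : Module.Basis (Fin 2) (RatFunc k) E, ToroidalForms.toroidalFormsWith b = {0} := by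
  refine ⟨Set.Subset.antisymm (fun f hf => ?_) ?_, fun E _ _ _ _ hE b =>
    ToroidalForms.toroidalFormsWith_eq_of_isQuadraticConstantExtension hE b⟩
  · obtain ⟨E, _, _, _, b, ω, τ, ν, hω, h⟩ :=
      ToroidalForms.exists_separable_quadratic_extension (k := k)
    exact (ToroidalForms.toroidalFormsWith_eq hω h).subset (hf E b)
  · rintro _ rfl E _ _ _ b
    exact ToroidalForms.zero_mem_toroidalFormsWith b
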